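/- All Hilbert spaces are finite-dimensional and complex. $D(H)$ is the set of density operators on $H$. $S(A,B)$ is the set of separable states on $A\otimes B$, i.e. the convex combinations of product states $\sigma_A\otimes\tau_B$ with $\sigma_A\in D(A)$, $\tau_B\in D(B)$. The generalized robustness of entanglement of $\rho\in D(A\otimes B)$ is $$R(\rho)=\inf\Bigl\{\lambda\ge 0 \;\Big|\; \tfrac{\rho+\lambda\omega}{1+\lambda}\in S(A,B)\text{ for some }\omega\in D(A\otimes B)\Bigr\}.$$ $\mathrm{LOCC}(A,B)$ denotes the set of completely positive trace-nonincreasing superoperators on $A\otimes B$ that are realized by finitely many rounds of local operations (with local ancillas, and possibly with some measurement outcomes discarded) and two-way classical communication. Let $A,B,C$ be $2^n$-dimensional and let $\rho$ be a state on $B\otimes C$. The optimal sampling overhead of a parallel cut of $n$ wires (the identity $\mathcal I^{\otimes n}$ from $A$ to $C$) with resource state $\rho$ is $$\gamma^{\rho}(\mathcal I^{\otimes n})=\inf\Bigl\{\sum_i|c_i| \;\Big|\; \mathcal V=\sum_i c_i\mathcal F_i,\ c_i\in\mathbb R,\ \sum_i c_i=1,\ \mathcal F_i\in\mathrm{LOCC}(A\otimes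 B,C),\ \operatorname{Tr}_{AB}[\mathcal V(\varphi\otimes\rho)]=\varphi\ \ \forall\varphi\in D(A)\Bigr\},$$ where the sums are finite and, in the last condition, $A$ and $C$ are identified through their computational bases. **Theorem.** Let $m\ge 2$ and, for $i=0,\dots,m-1$, let $\rho^{(i)}\in D(A_i\otimes B_i)$ be a density operator, where $A_i$ and $B_i$ are $2^{k_i}$-dimensional Hilbert spaces; put $n=\sum_{i=0}^{m-1}k_i$. Suppose that every $\rho^{(i)}$ is a non-maximally entangled (NME) state in the sense that $0\le R(\rho^{(i)})<2^{k_i}-1$. Let $\rho=\bigotimes_{i=0}^{m-1}\rho^{(i)}$, regarded as a bipartite state between $A=\bigotimes_i A_i$ and $B=\bigotimes_i B_i$. Then $$\prod_{i=0}^{m-1}\gamma^{\rho^{(i)}}(\mathcal I^{\otimes k_i})>\gamma^{\rho}(\mathcal I^{\otimes n}).$$ -/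

import Mathlib

open scoped Kronecker ComplexOrder

noncomputable section

namespace WireCut

/-- The computational basis of a register of `n` qubits. Operators on the register are the complex
matrices indexed by it, and operators on a tensor product `A ⊗ B` are the matrices indexed by the
product of the bases of `A` and `B`. -/
abbrev Qubits (n : ℕ) : Type := Fin n → Fin 2

/-- Superoperators, i.e. linear maps from the operators on one space to those on another. -/
abbrev SuperOp (a a' : Type) : Type := Matrix a a ℂ →ₗ[ℂ] Matrix a' a' ℂ

/-- `ρ ∈ D(H)`: density operators. -/
def IsDensity {a : Type} [Fintype a] (ρ : Matrix a a ℂ) : Prop :=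
  ρ.PosSemidef ∧ ρ.trace = 1

/-- `S(A, B)`: the separable states, i.e. the convex combinations of product states. -/
def separableStates (a b : Type) [Fintype a] [Fintype b] : Set (Matrix (a × b) (a × b) ℂ) :=
  convexHull ℝ {X | ∃ (σ : Matrix a a ℂ) (τ : Matrix b b ℂ),
    IsDensity σ ∧ IsDensity τ ∧ X = σ ⊗ₖ τ}

/-- The generalized robustness of entanglement of a bipartite state. -/
def robustness {a b : Type} [Fintype a] [Fintype b] (ρ : Matrix (a × b) (a × b) ℂ) : ℝ :=
  sInf {l : ℝ | 0 ≤ l ∧ ∃ ω : Matrix (a × b) (a × b) ℂ, IsDensity ω ∧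
    (1 + l)⁻¹ • (ρ + l • ω) ∈ separableStates a b}

/-- The superoperator `X ↦ K X K†`. -/
def krausMap {a a' : Type} [Fintype a] (K : Matrix a' a ℂ) : SuperOp a a' where
  toFun X := K * X * K.conjTranspose
  map_add' X Y := by rw [Matrix.mul_add, Matrix.add_mul]
  map_smul' r X := by simp

/-- `IsLOCC a b Λ`: the superoperator `Λ`, taking operators on `A ⊗ B` to operators on `A' ⊗ B'`, is
completely positive trace-nonincreasing and realized by a protocol of local operations and classical
communication with finitely many rounds.

In a round, one of the two parties applies a local quantum operation with Kraus operators `K j`,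
possibly changing the dimension of the local space (adding or discarding local ancillas), and
announces `j`; the parties then continue with a protocol that may depend on `j`. Outcomes may be
discarded, whence `∑ j, (K j)† K j ≤ 1` instead of equality. An outcome that is to be kept secret
is one that the subsequent protocols ignore. -/
inductive IsLOCC {a' b' : Type} [Fintype a'] [Fintype b'] [DecidableEq a'] [DecidableEq b'] :
    ∀ (a b : Type) [Fintype a] [Fintype b] [DecidableEq a] [DecidableEq b],
      SuperOp (a × b) (a' × b') → Prop
  | done : IsLOCC a' b' LinearMap.id
  | left {a b a₁ : Type} [Fintype a] [Fintype b] [Fintype a₁]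
      [DecidableEq a] [DecidableEq b] [DecidableEq a₁]
      (N : ℕ) (K : Fin N → Matrix a₁ a ℂ)
      (hK : (1 - ∑ j, (K j).conjTranspose * K j).PosSemidef)
      (Λ : Fin N → SuperOp (a₁ × b) (a' × b')) (hΛ : ∀ j, IsLOCC a₁ b (Λ j)) :
      IsLOCC a b (∑ j, Λ j ∘ₗ krausMap (K j ⊗ₖ (1 : Matrix b b ℂ)))
  | right {a b b₁ : Type} [Fintype a] [Fintype b] [Fintype b₁]
      [DecidableEq a] [DecidableEq b] [DecidableEq b₁]
      (N : ℕ) (K : Fin N → Matrix b₁ b ℂ)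
      (hK : (1 - ∑ j, (K j).conjTranspose * K j).PosSemidef)
      (Λ : Fin N → SuperOp (a × b₁) (a' × b')) (hΛ : ∀ j, IsLOCC a b₁ (Λ j)) :
      IsLOCC a b (∑ j, Λ j ∘ₗ krausMap ((1 : Matrix a a ℂ) ⊗ₖ K j))

/-- The partial trace over the first tensor factor. -/
def traceFirst {a b : Type} [Fintype a] (X : Matrix (a × b) (a × b) ℂ) : Matrix b b ℂ :=
  Matrix.of fun y y' => ∑ x, X (x, y) (x, y')

/-- The operator `φ_A ⊗ ρ_{BC}`, regarded as an operator on `(A ⊗ B) ⊗ C`. -/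
def withResource {a b c : Type} (φ : Matrix a a ℂ) (ρ : Matrix (b × c) (b × c) ℂ) :
    Matrix ((a × b) × c) ((a × b) × c) ℂ :=
  (φ ⊗ₖ ρ).submatrix (Equiv.prodAssoc a b c) (Equiv.prodAssoc a b c)

/-- `∑ i, c i F i` is a quasiprobability decomposition, into operations in `LOCC(A ⊗ B, C)`, of a
superoperator `V` on `A ⊗ B ⊗ C` that implements the identity from `A` to `C` by means of the
resource state `ρ` on `B ⊗ C`: the sum of the coefficients is one, and
`Tr_{AB} [V (φ ⊗ ρ)] = φ` for every density operator `φ`. The spaces `A`, `B` and `C` have the same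
dimension, and `d` indexes an orthonormal basis of each. -/
def IsWireCut {d : Type} [Fintype d] [DecidableEq d] (ρ : Matrix (d × d) (d × d) ℂ)
    {N : ℕ} (c : Fin N → ℝ) (F : Fin N → SuperOp ((d × d) × d) ((d × d) × d)) : Prop :=
  (∀ i, IsLOCC (d × d) d (F i)) ∧ ∑ i, c i = 1 ∧
    ∀ φ : Matrix d d ℂ, IsDensity φ →
      traceFirst ((∑ i, (c i : ℂ) • F i) (withResource φ ρ)) = φ

/-- The optimal sampling overhead for cutting the identity with the resource state `ρ`. For
`d = Qubits n` this is the overhead of the parallel cut of `n` wires. -/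
def overhead {d : Type} [Fintype d] [DecidableEq d] (ρ : Matrix (d × d) (d × d) ℂ) : ℝ :=
  sInf {κ : ℝ | ∃ (N : ℕ) (c : Fin N → ℝ) (F : Fin N → SuperOp ((d × d) × d) ((d × d) × d)),
    IsWireCut ρ c F ∧ κ = ∑ i, |c i|}

/-- The `i`-th block of a basis label of the joint register of `∑ i, k i` qubits. -/
def block {m : ℕ} {k : Fin m → ℕ} (x : Qubits (∑ i, k i)) (i : Fin m) : Qubits (k i) :=
  fun j => x (finSigmaFinEquiv ⟨i, j⟩)

/-- The composite state `⨂ i, ρ i`, regarded as a bipartite operator on `A ⊗ B` with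
`A = ⨂ i, A i` and `B = ⨂ i, B i`. -/
def compositeState {m : ℕ} {k : Fin m → ℕ}
    (ρ : ∀ i, Matrix (Qubits (k i) × Qubits (k i)) (Qubits (k i) × Qubits (k i)) ℂ) :
    Matrix (Qubits (∑ i, k i) × Qubits (∑ i, k i)) (Qubits (∑ i, k i) × Qubits (∑ i, k i)) ℂ :=
  Matrix.of fun p q => ∏ i, ρ i (block p.1 i, block p.2 i) (block q.1 i, block q.2 i)

end WireCut

end

/-! The overhead is governed by one number. For a superoperator E from A to C that some LOCC
operation implements with the resource, let f = `fid E` / n² be its entanglement fidelity, where n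
is the dimension of A. The overhead is 2/f − 1 with f the supremum of these fidelities.

In one direction (`IsWireCut.exists_fid`), the fidelity is linear and equals 1 at the identity. The
positive coefficients of a cut of overhead κ add up to (κ + 1)/2, so one of its operations has f ≥
2/(κ + 1). In the other direction (`exists_isWireCut`), twirling turns an operation of fidelity f
into f · id + s · N, where N is a fixed LOCC-implementable map of fidelity 0. Solving for id gives a
cut of overhead 2/f − 1. Twirling is free because it only uses shared randomness and local unitaries
(`exists_isotropic_twirl`).

Protocols for the factors can be run in parallel and their fidelities multiply
(`exists_realizable_pi`), so (γ + 1)/2 is submultiplicative (`overhead_compositeState_le`).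
Moreover, 2∏(xᵢ + 1)/2 − 1 < ∏ xᵢ as soon as there are at least two factors and all xᵢ > 1.

The hypothesis on the robustness R supplies γ > 1 for every factor (`one_lt_overhead`): a separable
resource gives f ≤ 1/n, hence ρ gives f ≤ (1 + R)/n < 1. -/

noncomputable section

namespace WireCut

open Matrix

/-! ### Closure properties of LOCC: composition, mixing, product Kraus operators, parallel
execution. -/

section LOCC

variable {a b a' b' a'' b'' : Type} [Fintype a] [Fintype b] [Fintype a'] [Fintype b']
  [Fintype a''] [Fintype b''] [DecidableEq a] [DecidableEq b] [DecidableEq a'] [DecidableEq b']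
  [DecidableEq a''] [DecidableEq b'']

@[simp]
theorem krausMap_apply {x y : Type} [Fintype x] (K : Matrix y x ℂ) (X : Matrix x x ℂ) :
    krausMap K X = K * X * K.conjTranspose := rfl

theorem krausMap_comp {x y z : Type} [Fintype x] [Fintype y] (K : Matrix z y ℂ)
    (L : Matrix y x ℂ) : krausMap K ∘ₗ krausMap L = krausMap (K * L) := by
  ext1 X
  simp [Matrix.conjTranspose_mul, Matrix.mul_assoc]

/-- A round of the first party with outcomes in an arbitrary finite type. -/
theorem IsLOCC.left_fintype {ι a₁ : Type} [Fintype ι] [Fintype a₁] [DecidableEq a₁]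
    (K : ι → Matrix a₁ a ℂ) (hK : (1 - ∑ j, (K j).conjTranspose * K j).PosSemidef)
    (Λ : ι → SuperOp (a₁ × b) (a' × b')) (hΛ : ∀ j, IsLOCC a₁ b (Λ j)) :
    IsLOCC a b (∑ j, Λ j ∘ₗ krausMap (K j ⊗ₖ (1 : Matrix b b ℂ))) := by
  classical
  have e := (Fintype.equivFin ι).symm
  rw [← e.sum_comp]
  rw [← e.sum_comp] at hK
  exact IsLOCC.left _ (fun j => K (e j)) hK (fun j => Λ (e j)) (fun j => hΛ _)

/-- A round of the second party with outcomes in an arbitrary finite type. -/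
theorem IsLOCC.right_fintype {ι b₁ : Type} [Fintype ι] [Fintype b₁] [DecidableEq b₁]
    (K : ι → Matrix b₁ b ℂ) (hK : (1 - ∑ j, (K j).conjTranspose * K j).PosSemidef)
    (Λ : ι → SuperOp (a × b₁) (a' × b')) (hΛ : ∀ j, IsLOCC a b₁ (Λ j)) :
    IsLOCC a b (∑ j, Λ j ∘ₗ krausMap ((1 : Matrix a a ℂ) ⊗ₖ K j)) := by
  classical
  have e := (Fintype.equivFin ι).symm
  rw [← e.sum_comp]
  rw [← e.sum_comp] at hK
  exact IsLOCC.right _ (fun j => K (e j)) hK (fun j => Λ (e j)) (fun j => hΛ _)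

theorem IsLOCC.comp {Λ' : SuperOp (a' × b') (a'' × b'')} (h' : IsLOCC a' b' Λ')
    {Λ : SuperOp (a × b) (a' × b')} (h : IsLOCC a b Λ) : IsLOCC a b (Λ' ∘ₗ Λ) := by
  induction h with
  | done => exact h'
  | left N K hK Λ hΛ ih =>
    have := IsLOCC.left N K hK _ ih
    convert this using 1
    ext1 X; simp
  | right N K hK Λ hΛ ih =>
    have := IsLOCC.right N K hK _ ih
    convert this using 1
    ext1 X; simp

/-- Local isometries are LOCC. -/
theorem IsLOCC.krausMap_kronecker (K : Matrix a' a ℂ) (hK : K.conjTranspose * K = 1)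
    (L : Matrix b' b ℂ) (hL : L.conjTranspose * L = 1) :
    IsLOCC a b (krausMap (K ⊗ₖ L)) := by
  have h₁ : IsLOCC a' b (krausMap ((1 : Matrix a' a' ℂ) ⊗ₖ L)) := by
    have := IsLOCC.right_fintype (a := a') (ι := Unit) (fun _ => L)
      (by simp [hL, Matrix.PosSemidef.zero]) (fun _ => LinearMap.id) (fun _ => IsLOCC.done)
    simpa using this
  have h₂ := IsLOCC.left_fintype (b := b) (ι := Unit) (fun _ => K)
      (by simp [hK, Matrix.PosSemidef.zero]) (fun _ => _) (fun _ => h₁)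
  simpa [krausMap_comp, ← Matrix.mul_kronecker_mul] using h₂

/-- Mixtures of LOCC operations, obtained with shared randomness, are LOCC. -/
theorem IsLOCC.sum_smul {ι : Type} [Fintype ι] (p : ι → ℝ) (hp : ∀ j, 0 ≤ p j)
    (hp' : ∑ j, p j ≤ 1) (Λ : ι → SuperOp (a × b) (a' × b')) (hΛ : ∀ j, IsLOCC a b (Λ j)) :
    IsLOCC a b (∑ j, (p j : ℂ) • Λ j) := by
  -- The first party measures with the trivial Kraus operators √(p j) · 1 and announces j, which is
  -- a shared random variable.
  have := IsLOCC.left_fintype (fun j => ((Real.sqrt (p j) : ℝ) : ℂ) • (1 : Matrix a a ℂ)) ?_ Λ hΛ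
  · convert this using 2 with j
    ext1 X
    simp [Matrix.smul_kronecker, smul_smul, Real.mul_self_sqrt (hp j)]
  · have : (1 - ∑ j, (((Real.sqrt (p j) : ℝ) : ℂ) • (1 : Matrix a a ℂ)).conjTranspose *
        (((Real.sqrt (p j) : ℝ) : ℂ) • (1 : Matrix a a ℂ))) =
        ((1 - ∑ j, p j : ℝ) : ℂ) • (1 : Matrix a a ℂ) := by
      simp [smul_smul, fun j => Real.mul_self_sqrt (hp j), sub_smul, Finset.sum_smul]
    rw [this]
    exact Matrix.PosSemidef.one.smul (by exact_mod_cast sub_nonneg.2 hp')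

/-- Kraus operators on the first factor of a tensor product. -/
theorem posSemidef_one_sub_sum_kronecker_one {ι x y z : Type} [Fintype ι] [Fintype x] [Fintype y]
    [Fintype z] [DecidableEq x] [DecidableEq z] (K : ι → Matrix y x ℂ)
    (hK : (1 - ∑ j, (K j).conjTranspose * K j).PosSemidef) :
    (1 - ∑ j, (K j ⊗ₖ (1 : Matrix z z ℂ)).conjTranspose *
      (K j ⊗ₖ (1 : Matrix z z ℂ))).PosSemidef := by
  have h := hK.kronecker (Matrix.PosSemidef.one (n := z) (R := ℂ))
  have e : (1 - ∑ j, (K j).conjTranspose * K j) ⊗ₖ (1 : Matrix z z ℂ) =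
      1 - ∑ j, (K j ⊗ₖ (1 : Matrix z z ℂ)).conjTranspose * (K j ⊗ₖ (1 : Matrix z z ℂ)) := by
    simp only [Matrix.conjTranspose_kronecker, ← Matrix.mul_kronecker_mul,
      Matrix.conjTranspose_one, Matrix.mul_one]
    ext ⟨p, p'⟩ ⟨q, q'⟩
    by_cases h : p' = q' <;>
    simp [Matrix.kroneckerMap_apply, Matrix.sum_apply, Matrix.one_apply, h]
  rw [e] at h
  exact h

/-- Kraus operators on the second factor of a tensor product. -/
theorem posSemidef_one_sub_sum_one_kronecker {ι x y z : Type} [Fintype ι] [Fintype x] [Fintype y]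
    [Fintype z] [DecidableEq x] [DecidableEq z] (K : ι → Matrix y x ℂ)
    (hK : (1 - ∑ j, (K j).conjTranspose * K j).PosSemidef) :
    (1 - ∑ j, ((1 : Matrix z z ℂ) ⊗ₖ K j).conjTranspose *
      ((1 : Matrix z z ℂ) ⊗ₖ K j)).PosSemidef := by
  have h := (Matrix.PosSemidef.one (n := z) (R := ℂ)).kronecker hK
  have e : (1 : Matrix z z ℂ) ⊗ₖ (1 - ∑ j, (K j).conjTranspose * K j) =
      1 - ∑ j, ((1 : Matrix z z ℂ) ⊗ₖ K j).conjTranspose * ((1 : Matrix z z ℂ) ⊗ₖ K j) := by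
    simp only [Matrix.conjTranspose_kronecker, ← Matrix.mul_kronecker_mul,
      Matrix.conjTranspose_one, Matrix.mul_one]
    ext ⟨p, p'⟩ ⟨q, q'⟩
    by_cases h : p = q <;>
    simp [Matrix.kroneckerMap_apply, Matrix.sum_apply, Matrix.one_apply, h]
  rw [e] at h
  exact h

/-- LOCC operations are separable: they have Kraus operators of product form. -/
theorem IsLOCC.exists_kraus {Λ : SuperOp (a × b) (a' × b')} (h : IsLOCC a b Λ) :
    ∃ (ι : Type) (_ : Fintype ι) (P : ι → Matrix a' a ℂ) (Q : ι → Matrix b' b ℂ),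
      Λ = ∑ j, krausMap (P j ⊗ₖ Q j) ∧
      (1 - ∑ j, (P j ⊗ₖ Q j).conjTranspose * (P j ⊗ₖ Q j)).PosSemidef := by
  -- Composing rounds preserves the subnormalization, since 1 − ∑ (LK)†(LK) = (1 − ∑ K†K) + ∑ K†(1 −
  -- ∑ L†L)K is a sum of positive semidefinite terms.
  have key : ∀ {x y z : Type} [Fintype x] [Fintype y] [Fintype z] [DecidableEq x] [DecidableEq y]
      [DecidableEq z] {ι : Type} [Fintype ι] {κ : ι → Type} [∀ i, Fintype (κ i)]
      (K : ι → Matrix y x ℂ) (L : ∀ i, κ i → Matrix z y ℂ),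
      (1 - ∑ j, (K j).conjTranspose * K j).PosSemidef →
      (∀ j, (1 - ∑ l, (L j l).conjTranspose * L j l).PosSemidef) →
      (1 - ∑ q : Σ j, κ j, (L q.1 q.2 * K q.1).conjTranspose * (L q.1 q.2 * K q.1)).PosSemidef := by
    intro x y z _ _ _ _ _ _ ι _ κ _ K L hK hL
    have : (1 - ∑ q : Σ j, κ j, (L q.1 q.2 * K q.1).conjTranspose * (L q.1 q.2 * K q.1)) =
        (1 - ∑ j, (K j).conjTranspose * K j) +
          ∑ j, (K j).conjTranspose * (1 - ∑ l, (L j l).conjTranspose * L j l) * K j := by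
      simp only [Fintype.sum_sigma, Matrix.mul_sub, Matrix.sub_mul, Finset.sum_sub_distrib,
        Matrix.mul_one, Matrix.mul_sum, Matrix.sum_mul, Matrix.conjTranspose_mul, Matrix.mul_assoc]
      abel
    rw [this]
    exact hK.add (Matrix.posSemidef_sum _ fun j _ => (hL j).conjTranspose_mul_mul_same _)
  induction h with
  | done => exact ⟨Unit, inferInstance, fun _ => 1, fun _ => 1, by ext1 X; simp,
      by simp [Matrix.PosSemidef.zero]⟩
  | @left a b a₁ _ _ _ _ _ _ N K hK Λ hΛ ih =>
    choose κ iκ P Q hPQ hps using ih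
    refine ⟨Σ j, κ j, inferInstance, fun q => P q.1 q.2 * K q.1, fun q => Q q.1 q.2, ?_, ?_⟩
    · conv_lhs => enter [2, j]; rw [hPQ j]
      simp only [Fintype.sum_sigma]
      refine Finset.sum_congr rfl fun j _ => ?_
      ext1 X
      simp only [LinearMap.sum_apply, LinearMap.comp_apply]
      refine Finset.sum_congr rfl fun l _ => ?_
      rw [← LinearMap.comp_apply, krausMap_comp, ← Matrix.mul_kronecker_mul, Matrix.mul_one]
    · have := key (fun j => K j ⊗ₖ (1 : Matrix b b ℂ)) (fun j l => P j l ⊗ₖ Q j l) ?_ hps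
      · simpa only [← Matrix.mul_kronecker_mul, Matrix.mul_one] using this
      · exact posSemidef_one_sub_sum_kronecker_one K hK
  | @right a b b₁ _ _ _ _ _ _ N K hK Λ hΛ ih =>
    choose κ iκ P Q hPQ hps using ih
    refine ⟨Σ j, κ j, inferInstance, fun q => P q.1 q.2, fun q => Q q.1 q.2 * K q.1, ?_, ?_⟩
    · conv_lhs => enter [2, j]; rw [hPQ j]
      simp only [Fintype.sum_sigma]
      refine Finset.sum_congr rfl fun j _ => ?_
      ext1 X
      simp only [LinearMap.sum_apply, LinearMap.comp_apply]
      refine Finset.sum_congr rfl fun l _ => ?_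
      rw [← LinearMap.comp_apply, krausMap_comp, ← Matrix.mul_kronecker_mul, Matrix.mul_one]
    · have := key (fun j => (1 : Matrix a a ℂ) ⊗ₖ K j) (fun j l => P j l ⊗ₖ Q j l) ?_ hps
      · simpa only [← Matrix.mul_kronecker_mul, Matrix.mul_one] using this
      · exact posSemidef_one_sub_sum_one_kronecker K hK

/-- The tensor product of two bipartite operators, as a bipartite operator. -/
def tensor {a b x y : Type} (Y : Matrix (a × b) (a × b) ℂ) (Z : Matrix (x × y) (x × y) ℂ) :
    Matrix ((a × x) × (b × y)) ((a × x) × (b × y)) ℂ :=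
  (Y ⊗ₖ Z).submatrix (Equiv.prodProdProdComm a x b y) (Equiv.prodProdProdComm a x b y)

theorem krausMap_tensor {a b a₁ b₁ x y x₁ y₁ : Type} [Fintype a] [Fintype b] [Fintype x]
    [Fintype y]
    (K : Matrix a₁ a ℂ) (L : Matrix b₁ b ℂ) (K' : Matrix x₁ x ℂ) (L' : Matrix y₁ y ℂ)
    (Y : Matrix (a × b) (a × b) ℂ) (Z : Matrix (x × y) (x × y) ℂ) :
    krausMap ((K ⊗ₖ K') ⊗ₖ (L ⊗ₖ L')) (tensor Y Z) =
      tensor (krausMap (K ⊗ₖ L) Y) (krausMap (K' ⊗ₖ L') Z) := by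
  have h : (K ⊗ₖ K') ⊗ₖ (L ⊗ₖ L') = ((K ⊗ₖ L) ⊗ₖ (K' ⊗ₖ L')).submatrix
      (Equiv.prodProdProdComm a₁ x₁ b₁ y₁) (Equiv.prodProdProdComm a x b y) := by
    ext ⟨⟨i, j⟩, k, l⟩ ⟨⟨i', j'⟩, k', l'⟩
    simp [Matrix.kroneckerMap_apply]; ring
  rw [h]
  simp only [krausMap_apply, tensor, Matrix.conjTranspose_submatrix, Matrix.submatrix_mul_equiv,
    Matrix.conjTranspose_kronecker, Matrix.mul_kronecker_mul]

theorem tensor_sum_left {ι a b x y : Type} (s : Finset ι) (Y : ι → Matrix (a × b) (a × b) ℂ)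
    (Z : Matrix (x × y) (x × y) ℂ) : tensor (∑ j ∈ s, Y j) Z = ∑ j ∈ s, tensor (Y j) Z := by
  ext p q
  simp [tensor, Matrix.kroneckerMap_apply, Matrix.sum_apply, Finset.sum_mul]

theorem tensor_sum_right {ι a b x y : Type} (s : Finset ι) (Y : Matrix (a × b) (a × b) ℂ)
    (Z : ι → Matrix (x × y) (x × y) ℂ) : tensor Y (∑ j ∈ s, Z j) = ∑ j ∈ s, tensor Y (Z j) := by
  ext p q
  simp [tensor, Matrix.kroneckerMap_apply, Matrix.sum_apply, Finset.mul_sum]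

/-- An LOCC operation applied to the first factor of a tensor product. -/
theorem IsLOCC.exists_tensor_left {x y : Type} [Fintype x] [Fintype y] [DecidableEq x]
    [DecidableEq y] {Λ : SuperOp (a × b) (a' × b')} (h : IsLOCC a b Λ) :
    ∃ G : SuperOp ((a × x) × (b × y)) ((a' × x) × (b' × y)), IsLOCC (a × x) (b × y) G ∧
      ∀ Y Z, G (tensor Y Z) = tensor (Λ Y) Z := by
  induction h with
  | done => exact ⟨_, IsLOCC.done, fun Y Z => rfl⟩
  | left N K hK Λ hΛ ih =>
    choose G hG hG' using ih
    refine ⟨_, IsLOCC.left N (fun j => K j ⊗ₖ (1 : Matrix x x ℂ))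
      (posSemidef_one_sub_sum_kronecker_one K hK) G hG, fun Y Z => ?_⟩
    simp only [LinearMap.sum_apply, LinearMap.comp_apply, tensor_sum_left]
    refine Finset.sum_congr rfl fun j _ => ?_
    rw [← Matrix.one_kronecker_one, krausMap_tensor, hG']
    simp
  | right N K hK Λ hΛ ih =>
    choose G hG hG' using ih
    refine ⟨_, IsLOCC.right N (fun j => K j ⊗ₖ (1 : Matrix y y ℂ))
      (posSemidef_one_sub_sum_kronecker_one K hK) G hG, fun Y Z => ?_⟩
    simp only [LinearMap.sum_apply, LinearMap.comp_apply, tensor_sum_left]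
    refine Finset.sum_congr rfl fun j _ => ?_
    rw [← Matrix.one_kronecker_one, krausMap_tensor, hG']
    simp

/-- An LOCC operation applied to the second factor of a tensor product. -/
theorem IsLOCC.exists_tensor_right {x y : Type} [Fintype x] [Fintype y] [DecidableEq x]
    [DecidableEq y] {Λ : SuperOp (a × b) (a' × b')} (h : IsLOCC a b Λ) :
    ∃ G : SuperOp ((x × a) × (y × b)) ((x × a') × (y × b')), IsLOCC (x × a) (y × b) G ∧
      ∀ Y Z, G (tensor Y Z) = tensor Y (Λ Z) := by
  induction h with
  | done => exact ⟨_, IsLOCC.done, fun Y Z => rfl⟩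
  | left N K hK Λ hΛ ih =>
    choose G hG hG' using ih
    refine ⟨_, IsLOCC.left N (fun j => (1 : Matrix x x ℂ) ⊗ₖ K j)
      (posSemidef_one_sub_sum_one_kronecker K hK) G hG, fun Y Z => ?_⟩
    simp only [LinearMap.sum_apply, LinearMap.comp_apply, tensor_sum_right]
    refine Finset.sum_congr rfl fun j _ => ?_
    rw [← Matrix.one_kronecker_one, krausMap_tensor, hG']
    simp
  | right N K hK Λ hΛ ih =>
    choose G hG hG' using ih
    refine ⟨_, IsLOCC.right N (fun j => (1 : Matrix y y ℂ) ⊗ₖ K j)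
      (posSemidef_one_sub_sum_one_kronecker K hK) G hG, fun Y Z => ?_⟩
    simp only [LinearMap.sum_apply, LinearMap.comp_apply, tensor_sum_right]
    refine Finset.sum_congr rfl fun j _ => ?_
    rw [← Matrix.one_kronecker_one, krausMap_tensor, hG']
    simp

/-- Two LOCC protocols can be run in parallel. -/
theorem IsLOCC.exists_tensor {x y x' y' : Type} [Fintype x] [Fintype y] [Fintype x'] [Fintype y']
    [DecidableEq x] [DecidableEq y] [DecidableEq x'] [DecidableEq y']
    {Λ : SuperOp (a × b) (a' × b')} (h : IsLOCC a b Λ)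
    {Γ : SuperOp (x × y) (x' × y')} (h' : IsLOCC x y Γ) :
    ∃ G : SuperOp ((a × x) × (b × y)) ((a' × x') × (b' × y')), IsLOCC (a × x) (b × y) G ∧
      ∀ Y Z, G (tensor Y Z) = tensor (Λ Y) (Γ Z) := by
  obtain ⟨G, hG, hG'⟩ := h.exists_tensor_left (x := x) (y := y)
  obtain ⟨L, hL, hL'⟩ := h'.exists_tensor_right (x := a') (y := b')
  exact ⟨_, hL.comp hG, fun Y Z => by rw [LinearMap.comp_apply, hG', hL']⟩

end LOCC

/-! ### Relabelling of bases as Kraus maps. -/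

section Reindex

theorem krausMap_one_submatrix {x y : Type} [Fintype x] [DecidableEq x] (e : y → x)
    (X : Matrix x x ℂ) :
    krausMap ((1 : Matrix x x ℂ).submatrix e id) X = X.submatrix e e := by
  ext i j
  simp [Matrix.mul_apply, Matrix.one_apply]

theorem conjTranspose_one_submatrix_mul {x y : Type} [Fintype x] [Fintype y] [DecidableEq x]
    (e : y ≃ x) : ((1 : Matrix x x ℂ).submatrix e id).conjTranspose *
      (1 : Matrix x x ℂ).submatrix e id = 1 := by
  simp [Matrix.conjTranspose_submatrix]

theorem one_submatrix_kronecker_one_submatrix {x y x' y' : Type} [DecidableEq x] [DecidableEq x']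
    (e : y → x) (f : y' → x') :
    (1 : Matrix x x ℂ).submatrix e id ⊗ₖ (1 : Matrix x' x' ℂ).submatrix f id =
      (1 : Matrix (x × x') (x × x') ℂ).submatrix (Prod.map e f) id := by
  rw [← Matrix.one_kronecker_one]
  rfl

end Reindex

/-! ### Superoperators implementable by LOCC with a fixed resource. -/

section Realizable

variable {d : Type} [Fintype d] [DecidableEq d]

/-- The superoperators from `A` to `C` that LOCC operations implement with the resource `ρ`. -/
def Realizable (ρ : Matrix (d × d) (d × d) ℂ) (E : SuperOp d d) : Prop :=
  ∃ F : SuperOp ((d × d) × d) ((d × d) × d), IsLOCC (d × d) d F ∧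
    ∀ X, E X = traceFirst (F (withResource X ρ))

theorem traceFirst_sum {ι a b : Type} [Fintype a] (s : Finset ι)
    (X : ι → Matrix (a × b) (a × b) ℂ) : traceFirst (∑ j ∈ s, X j) = ∑ j ∈ s, traceFirst (X j) := by
  ext y y'
  simp [traceFirst, Matrix.sum_apply]
  exact Finset.sum_comm

theorem traceFirst_smul {a b : Type} [Fintype a] (c : ℂ) (X : Matrix (a × b) (a × b) ℂ) :
    traceFirst (c • X) = c • traceFirst X := by
  ext y y'
  simp [traceFirst, Finset.mul_sum]

theorem traceFirst_krausMap {a b c : Type} [Fintype a] [Fintype b] [DecidableEq a]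
    (V : Matrix c b ℂ) (X : Matrix (a × b) (a × b) ℂ) :
    traceFirst (krausMap ((1 : Matrix a a ℂ) ⊗ₖ V) X) = krausMap V (traceFirst X) := by
  have h : ∀ Y : Matrix (a × b) (a × b) ℂ,
      traceFirst Y = ∑ x, Y.submatrix (Prod.mk x) (Prod.mk x) := by
    intro Y
    ext y y'
    simp [traceFirst, Matrix.sum_apply]
  have h' : ∀ Y : Matrix (a × c) (a × c) ℂ,
      traceFirst Y = ∑ x, Y.submatrix (Prod.mk x) (Prod.mk x) := by
    intro Y
    ext y y'
    simp [traceFirst, Matrix.sum_apply]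
  rw [h, h', map_sum]
  refine Finset.sum_congr rfl fun x _ => ?_
  ext y y'
  simp [Matrix.mul_apply, Matrix.kroneckerMap_apply, Fintype.sum_prod_type, Matrix.one_apply,
    ite_mul, apply_ite (starRingEnd ℂ)]

theorem withResource_krausMap {a b c a' : Type} [Fintype a] [Fintype b] [Fintype c]
    [DecidableEq b] [DecidableEq c] (U : Matrix a' a ℂ) (X : Matrix a a ℂ)
    (ρ : Matrix (b × c) (b × c) ℂ) :
    withResource (krausMap U X) ρ =
      krausMap ((U ⊗ₖ (1 : Matrix b b ℂ)) ⊗ₖ (1 : Matrix c c ℂ)) (withResource X ρ) := by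
  have h : (U ⊗ₖ (1 : Matrix b b ℂ)) ⊗ₖ (1 : Matrix c c ℂ) =
      (U ⊗ₖ (1 : Matrix (b × c) (b × c) ℂ)).submatrix (Equiv.prodAssoc a' b c)
        (Equiv.prodAssoc a b c) := by
    rw [← Matrix.one_kronecker_one]
    ext ⟨⟨i, j⟩, k⟩ ⟨⟨i', j'⟩, k'⟩
    simp only [Matrix.submatrix_apply, Equiv.prodAssoc_apply, Matrix.kroneckerMap_apply, mul_assoc]
  rw [h]
  simp only [krausMap_apply, withResource, Matrix.conjTranspose_submatrix,
    Matrix.submatrix_mul_equiv, Matrix.conjTranspose_kronecker, ← Matrix.mul_kronecker_mul]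
  simp

variable {ρ : Matrix (d × d) (d × d) ℂ}

/-- The sender applies U to the input and the receiver undoes it on the output. Both steps are
local, so conjugation costs nothing, and neither does twirling. -/
theorem Realizable.conj {E : SuperOp d d} (h : Realizable ρ E) (U : Matrix d d ℂ)
    (hU : U.conjTranspose * U = 1) :
    Realizable ρ (krausMap U.conjTranspose ∘ₗ E ∘ₗ krausMap U) := by
  obtain ⟨F, hF, hE⟩ := h
  have hU' : U * U.conjTranspose = 1 := mul_eq_one_comm.1 hU
  refine ⟨krausMap ((1 : Matrix (d × d) (d × d) ℂ) ⊗ₖ U.conjTranspose) ∘ₗ F ∘ₗ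
    krausMap ((U ⊗ₖ (1 : Matrix d d ℂ)) ⊗ₖ (1 : Matrix d d ℂ)),
    (IsLOCC.krausMap_kronecker _ (by simp) _ (by simpa using hU')).comp
      (hF.comp (IsLOCC.krausMap_kronecker _ ?_ _ (by simp))), fun X => ?_⟩
  · simp [Matrix.conjTranspose_kronecker, ← Matrix.mul_kronecker_mul, hU]
  · simp only [LinearMap.comp_apply, hE, withResource_krausMap, traceFirst_krausMap]

theorem Realizable.sum_smul {ι : Type} [Fintype ι] (p : ι → ℝ) (hp : ∀ j, 0 ≤ p j)
    (hp' : ∑ j, p j ≤ 1) (E : ι → SuperOp d d) (hE : ∀ j, Realizable ρ (E j)) :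
    Realizable ρ (∑ j, (p j : ℂ) • E j) := by
  choose F hF hE using hE
  refine ⟨_, IsLOCC.sum_smul p hp hp' F hF, fun X => ?_⟩
  simp only [LinearMap.sum_apply, LinearMap.smul_apply, hE, traceFirst_sum, traceFirst_smul]

/-- The average of `U† E (U X U†) U` over a finite family of unitaries `U`. -/
theorem Realizable.average {ι : Type} [Fintype ι] [Nonempty ι] {E : SuperOp d d}
    (h : Realizable ρ E) (U : ι → Matrix d d ℂ) (hU : ∀ j, (U j).conjTranspose * U j = 1) :
    Realizable ρ (∑ j, ((Fintype.card ι : ℂ)⁻¹) •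
      (krausMap (U j).conjTranspose ∘ₗ E ∘ₗ krausMap (U j))) := by
  have := Realizable.sum_smul (ρ := ρ) (fun _ : ι => (Fintype.card ι : ℝ)⁻¹)
    (fun _ => by positivity) (by simp) _ (fun j => h.conj (U j) (hU j))
  simpa only [Complex.ofReal_inv, Complex.ofReal_natCast] using this

/-- Measure in the computational basis and prepare a basis state that depends on the outcome. -/
def measurePrepare (g : d → d) : SuperOp d d where
  toFun X := ∑ i, X i i • Matrix.single (g i) (g i) 1
  map_add' X Y := by simp [add_smul, Finset.sum_add_distrib]
  map_smul' r X := by simp [Finset.smul_sum]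

theorem krausMap_single (i j : d) (X : Matrix d d ℂ) :
    krausMap (Matrix.single i j (1 : ℂ)) X = X j j • Matrix.single i i 1 := by
  simp [Matrix.conjTranspose_single, Matrix.single_mul_mul_single, Matrix.smul_single]

theorem trace_traceFirst {a b : Type} [Fintype a] [Fintype b] (X : Matrix (a × b) (a × b) ℂ) :
    (traceFirst X).trace = X.trace := by
  simp [Matrix.trace, traceFirst, Fintype.sum_prod_type]
  exact Finset.sum_comm

theorem trace_withResource {a b c : Type} [Fintype a] [Fintype b] [Fintype c] (X : Matrix a a ℂ)
    (ρ : Matrix (b × c) (b × c) ℂ) : (withResource X ρ).trace = X.trace * ρ.trace := by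
  rw [← Matrix.trace_kronecker]
  simp only [withResource, Matrix.trace, Matrix.diag_apply, Matrix.submatrix_apply]
  exact (Equiv.prodAssoc a b c).sum_comp (fun p => (X ⊗ₖ ρ) p p)

/-- The resource is ignored: the sender measures A and announces i, and the receiver discards its
half of the resource and prepares the state labelled g i. The resource enters only through its
trace. -/
theorem realizable_measurePrepare (hρ : ρ.trace = 1) (g : d → d) :
    Realizable ρ (measurePrepare g) := by
  have hr : ∀ i, IsLOCC (a' := d × d) (b' := d) (d × d) d
      (∑ c : d, krausMap ((1 : Matrix (d × d) (d × d) ℂ) ⊗ₖ (Matrix.single (g i) c (1 : ℂ)))) := by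
    intro i
    have := IsLOCC.right_fintype (a := d × d) (fun c : d => Matrix.single (g i) c (1 : ℂ)) ?_
      (fun _ => LinearMap.id) (fun _ => IsLOCC.done)
    · simpa using this
    · have : (∑ c : d, (Matrix.single (g i) c (1 : ℂ)).conjTranspose *
          Matrix.single (g i) c (1 : ℂ)) = 1 := by
        simp [Matrix.conjTranspose_single, Matrix.sum_single_one]
      rw [this, sub_self]
      exact Matrix.PosSemidef.zero
  have hl := IsLOCC.left_fintype (fun i : d => Matrix.single i i (1 : ℂ) ⊗ₖ (1 : Matrix d d ℂ))
    ?_ _ hr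
  · refine ⟨_, hl, fun X => ?_⟩
    rw [LinearMap.sum_apply, traceFirst_sum]
    simp only [measurePrepare, LinearMap.coe_mk, AddHom.coe_mk]
    refine Finset.sum_congr rfl fun i _ => ?_
    rw [LinearMap.comp_apply, ← withResource_krausMap, LinearMap.sum_apply, traceFirst_sum]
    simp only [traceFirst_krausMap, krausMap_single]
    rw [← Finset.sum_smul]
    change _ = (traceFirst _).trace • _
    rw [trace_traceFirst, trace_withResource, hρ]
    simp
  · apply posSemidef_one_sub_sum_kronecker_one
    have : (∑ c : d, (Matrix.single c c (1 : ℂ)).conjTranspose *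
        Matrix.single c c (1 : ℂ)) = 1 := by
      simp [Matrix.conjTranspose_single, Matrix.sum_single_one]
    rw [this, sub_self]
    exact Matrix.PosSemidef.zero

/-! ### Twirling a superoperator down to the span of the identity and the depolarizing map. -/

section Twirl

/-- `∑ i j, ⟨i| E(|i⟩⟨j|) |j⟩`, the entanglement fidelity of `E` times the square of the
dimension. -/
def fid (E : SuperOp d d) : ℂ := ∑ i, ∑ j, E (Matrix.single i j 1) i j

/-- The trace of `E(1)`. -/
def tr (E : SuperOp d d) : ℂ := ∑ i, ∑ k, E (Matrix.single i i 1) k k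

/-- `∑ i, ⟨i| E(|i⟩⟨i|) |i⟩`. -/
def diagFid (E : SuperOp d d) : ℂ := ∑ i, E (Matrix.single i i 1) i i

/-- The superoperator `X ↦ x X + y diag X + z (Tr X) 1`. -/
def symMap (x y z : ℂ) : SuperOp d d :=
  x • LinearMap.id + y • (Matrix.diagonalLinearMap d ℂ ℂ ∘ₗ Matrix.diagLinearMap d ℂ ℂ) +
    z • (Matrix.traceLinearMap d ℂ ℂ).smulRight 1

theorem symMap_single (x y z : ℂ) (i j k l : d) :
    symMap x y z (Matrix.single i j 1) k l = (if i = k ∧ j = l then x else 0) +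
      (if i = j ∧ k = l then (if i = k then y else 0) + z else 0) := by
  simp [symMap, Matrix.diagonal_apply, Matrix.single_apply, Matrix.one_apply]
  by_cases hij : i = j
  · subst hij
    by_cases hkl : k = l
    · subst hkl
      simp [add_assoc]
    · simp [hkl]
  · simp only [Matrix.trace_single_eq_of_ne i j (1 : ℂ) hij, hij, false_and, if_false, mul_zero,
      ite_self, add_zero, add_eq_left, ite_eq_right_iff]
    rintro rfl ⟨rfl, rfl⟩
    exact absurd rfl hij

theorem superOp_ext {E E' : SuperOp d d}
    (h : ∀ i j k l, E (Matrix.single i j 1) k l = E' (Matrix.single i j 1) k l) : E = E' := by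
  apply Matrix.ext_linearMap
  intro i j
  ext1
  ext k l
  simpa using h i j k l

/-- Conjugation by a diagonal unitary s multiplies the entry (k, l) of E(|i⟩⟨j|) by the character sᵢ
sⱼ⁻¹ sₖ⁻¹ sₗ. Averaging kills every entry whose character is nontrivial and keeps the others. -/
theorem exists_phase_twirl {E : SuperOp d d} (h : Realizable ρ E) :
    ∃ E' : SuperOp d d, Realizable ρ E' ∧
      (∀ i k, E' (Matrix.single i i 1) k k = E (Matrix.single i i 1) k k) ∧
      (∀ i j, E' (Matrix.single i j 1) i j = E (Matrix.single i j 1) i j) ∧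
      ∀ i j k l, ¬ (i = j ∧ k = l) → ¬ (i = k ∧ j = l) → E' (Matrix.single i j 1) k l = 0 := by
  -- Signs alone would not suffice: for i = l and j = k the character is sᵢ² sⱼ⁻², trivial on ±1 but
  -- not on fourth roots of unity.
  let G := rootsOfUnity 4 ℂ
  have : Fintype G := Fintype.ofFinite (rootsOfUnity 4 ℂ)
  have hstar : ∀ z : G, star ((z : ℂˣ) : ℂ) = (((z⁻¹ : G) : ℂˣ) : ℂ) := by
    intro z
    have hn : ‖((z : ℂˣ) : ℂ)‖ = 1 :=
      Complex.norm_eq_one_of_mem_rootsOfUnity z.2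
    have := Complex.inv_eq_conj hn
    rw [Complex.star_def, ← this]
    simp
  let U : (d → G) → Matrix d d ℂ := fun s => Matrix.diagonal fun i => ((s i : ℂˣ) : ℂ)
  have hU : ∀ s, (U s).conjTranspose * U s = 1 := by
    intro s
    simp only [U, Matrix.diagonal_conjTranspose, Matrix.diagonal_mul_diagonal, Pi.star_apply,
      hstar]
    simp
  let χ : d → d → d → d → (d → G) → ℂ := fun i j k l s =>
    (((s i * (s j)⁻¹ * ((s k)⁻¹ * s l) : G) : ℂˣ) : ℂ)
  have key : ∀ i j k l, (∑ s, ((Fintype.card (d → G) : ℂ)⁻¹) •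
      (krausMap (U s).conjTranspose ∘ₗ E ∘ₗ krausMap (U s))) (Matrix.single i j 1) k l =
      ((Fintype.card (d → G) : ℂ)⁻¹ * ∑ s, χ i j k l s) * E (Matrix.single i j 1) k l := by
    intro i j k l
    have hs : ∀ s, krausMap (U s) (Matrix.single i j 1) =
        (((s i * (s j)⁻¹ : G) : ℂˣ) : ℂ) • Matrix.single i j 1 := by
      intro s
      ext p q
      simp only [U, krausMap_apply, Matrix.diagonal_conjTranspose, Matrix.mul_diagonal,
        Matrix.diagonal_mul, Pi.star_apply, hstar, Matrix.smul_apply, Matrix.single_apply]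
      by_cases hp : i = p ∧ j = q
      · simp [hp.1, hp.2]
      · simp [hp]
    simp only [LinearMap.sum_apply, LinearMap.smul_apply, LinearMap.comp_apply, hs, map_smul,
      Matrix.sum_apply, Matrix.smul_apply]
    rw [Finset.mul_sum, Finset.sum_mul]
    refine Finset.sum_congr rfl fun s _ => ?_
    simp only [U, krausMap_apply, Matrix.diagonal_conjTranspose, Matrix.mul_diagonal,
        Matrix.diagonal_mul, Pi.star_apply, hstar, star_star, χ, smul_eq_mul]
    simp
    ring
  refine ⟨_, h.average U hU, fun i k => ?_, fun i j => ?_, fun i j k l h₁ h₂ => ?_⟩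
  · rw [key]
    simp [χ]
  · rw [key]
    have : ∀ s, χ i j i j s = 1 := by intro s; simp [χ, mul_comm, mul_left_comm]
    simp [this]
  · rw [key]
    have hmul : ∀ t s, χ i j k l (t * s) = χ i j k l t * χ i j k l s := by
      intro t s
      simp only [χ, ← Units.val_mul, ← Subgroup.coe_mul, Pi.mul_apply]
      congr 2
      simp only [mul_inv]
      ac_rfl
    obtain ⟨t, ht⟩ : ∃ t, χ i j k l t ≠ 1 := by
      let ω : G := ⟨Units.mk0 Complex.I Complex.I_ne_zero, by
        rw [mem_rootsOfUnity]; ext; simp⟩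
      have hω : ((ω : ℂˣ) : ℂ) = Complex.I := rfl
      have hI : Complex.I ≠ 1 := fun h => by simpa using congrArg Complex.re h
      by_cases hik : i = k
      · refine ⟨Pi.mulSingle l ω, ?_⟩
        have hjl : j ≠ l := fun hh => h₂ ⟨hik, hh⟩
        simp [χ, hik, Pi.mulSingle_eq_of_ne hjl, hω, hI]
      · by_cases hij : i = j
        · refine ⟨Pi.mulSingle l ω, ?_⟩
          have hkl : k ≠ l := fun hh => h₁ ⟨hij, hh⟩
          simp [χ, hij, Pi.mulSingle_eq_of_ne hkl, hω, hI]
        · refine ⟨Pi.mulSingle i ω, ?_⟩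
          by_cases hil : i = l
          · subst hil
            simp [χ, Pi.mulSingle_eq_of_ne (Ne.symm hij), Pi.mulSingle_eq_of_ne (Ne.symm hik), hω]
            norm_num
          · simp [χ, Pi.mulSingle_eq_of_ne (Ne.symm hij), Pi.mulSingle_eq_of_ne (Ne.symm hik),
              Pi.mulSingle_eq_of_ne (Ne.symm hil), hω, hI]
    -- A nontrivial character of a finite group sums to zero: translating by t multiplies the sum by
    -- χ(t) ≠ 1.
    have hsum : χ i j k l t * ∑ s, χ i j k l s = ∑ s, χ i j k l s := by
      rw [Finset.mul_sum, ← Equiv.sum_comp (Equiv.mulLeft t) (χ i j k l)]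
      simp [hmul]
    have : ∑ s, χ i j k l s = 0 := by
      by_contra hne
      exact ht (mul_right_cancel₀ hne (by rw [hsum, one_mul]))
    simp [this]

/-- Double transitivity of the symmetric group. It makes permutation averages of entries depend only
on which indices coincide. -/
theorem exists_perm_map_eq {d : Type} [DecidableEq d] {i j i' j' : d} (h : i ≠ j) (h' : i' ≠ j') :
    ∃ τ : Equiv.Perm d, τ i = i' ∧ τ j = j' := by
  refine ⟨Equiv.swap (Equiv.swap i i' j) j' * Equiv.swap i i', ?_, ?_⟩
  · rw [Equiv.Perm.mul_apply, Equiv.swap_apply_left]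
    refine Equiv.swap_apply_of_ne_of_ne (fun hh => h ?_) h'
    apply (Equiv.swap i i').injective
    rw [Equiv.swap_apply_left, ← hh]
  · rw [Equiv.Perm.mul_apply, Equiv.swap_apply_left]

/-- Averages over all permutations of a function of two distinct points. -/
theorem sum_perm_apply_eq (f : d → d → ℂ) {i j i' j' : d} (h : i ≠ j) (h' : i' ≠ j') :
    ∑ σ : Equiv.Perm d, f (σ i) (σ j) = ∑ σ : Equiv.Perm d, f (σ i') (σ j') := by
  obtain ⟨τ, hi, hj⟩ := exists_perm_map_eq h' h
  rw [← Equiv.sum_comp (Equiv.mulRight τ) (fun σ : Equiv.Perm d => f (σ i') (σ j'))]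
  simp [hi, hj]

theorem sum_perm_apply_eq' (f : d → ℂ) (i i' : d) :
    ∑ σ : Equiv.Perm d, f (σ i) = ∑ σ : Equiv.Perm d, f (σ i') := by
  rw [← Equiv.sum_comp (Equiv.mulRight (Equiv.swap i i')) (fun σ : Equiv.Perm d => f (σ i))]
  simp

theorem fid_symMap (x y z : ℂ) : fid (symMap (d := d) x y z) =
    (Fintype.card d : ℂ) * (Fintype.card d * x + y + z) := by
  simp [fid, symMap_single, Finset.sum_add_distrib]
  ring

theorem tr_symMap (x y z : ℂ) : tr (symMap (d := d) x y z) =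
    (Fintype.card d : ℂ) * (x + y + Fintype.card d * z) := by
  simp [tr, symMap_single, Finset.sum_add_distrib]
  ring

theorem diagFid_symMap (x y z : ℂ) : diagFid (symMap (d := d) x y z) =
    (Fintype.card d : ℂ) * (x + y + z) := by
  simp [diagFid, symMap_single]
  ring

/-- After the phase twirl, a permutation twirl averages the surviving entries over their orbits.
Only three orbits remain, hence three parameters. The three functionals are sums over whole orbits
and so are preserved. -/
theorem exists_monomial_twirl [Nontrivial d] {E : SuperOp d d} (h : Realizable ρ E) :
    ∃ x y z : ℂ, Realizable ρ (symMap x y z) ∧ fid (symMap (d := d) x y z) = fid E ∧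
      tr (symMap (d := d) x y z) = tr E ∧ diagFid (symMap (d := d) x y z) = diagFid E := by
  obtain ⟨E', hE', hd, hf, h0⟩ := exists_phase_twirl h
  let U : Equiv.Perm d → Matrix d d ℂ := fun σ => (1 : Matrix d d ℂ).submatrix σ.symm id
  have hU : ∀ σ, (U σ).conjTranspose * U σ = 1 := fun σ => conjTranspose_one_submatrix_mul σ.symm
  have hU' : ∀ σ, (U σ).conjTranspose = (1 : Matrix d d ℂ).submatrix σ id := by
    intro σ
    ext i j
    simp [U, Matrix.one_apply, Equiv.eq_symm_apply, eq_comm]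
  set n : ℂ := (Fintype.card (Equiv.Perm d) : ℂ)⁻¹ with hn
  set T := ∑ σ, n • (krausMap (U σ).conjTranspose ∘ₗ E' ∘ₗ krausMap (U σ)) with hT
  have hreal : Realizable ρ T := hE'.average U hU
  have key : ∀ i j k l, T (Matrix.single i j 1) k l =
      n * ∑ σ : Equiv.Perm d, E' (Matrix.single (σ i) (σ j) 1) (σ k) (σ l) := by
    intro i j k l
    rw [hT, Finset.mul_sum]
    simp only [LinearMap.sum_apply, LinearMap.smul_apply, LinearMap.comp_apply, hU',
      krausMap_one_submatrix, Matrix.sum_apply, Matrix.smul_apply, smul_eq_mul, U,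
      Matrix.submatrix_apply]
    refine Finset.sum_congr rfl fun σ _ => ?_
    congr 1
    have : (Matrix.single i j (1 : ℂ)).submatrix σ.symm σ.symm = Matrix.single (σ i) (σ j) 1 := by
      ext p q
      simp [Matrix.single_apply, Equiv.eq_symm_apply]
    rw [this]
  have hn0 : n * Fintype.card (Equiv.Perm d) = 1 :=
    inv_mul_cancel₀ (Nat.cast_ne_zero.2 Fintype.card_ne_zero)
  obtain ⟨u, v, huv⟩ := exists_pair_ne d
  -- The averages over the three orbits: population kept, coherence kept, and population moved to
  -- another basis state.
  let α := n * ∑ σ : Equiv.Perm d, E' (Matrix.single (σ u) (σ u) 1) (σ u) (σ u)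
  let β := n * ∑ σ : Equiv.Perm d, E' (Matrix.single (σ u) (σ v) 1) (σ u) (σ v)
  let γ := n * ∑ σ : Equiv.Perm d, E' (Matrix.single (σ u) (σ u) 1) (σ v) (σ v)
  have hTs : T = symMap β (α - β - γ) γ := by
    apply superOp_ext
    intro i j k l
    rw [key, symMap_single]
    by_cases hij : i = j
    · subst hij
      by_cases hkl : k = l
      · subst hkl
        by_cases hik : i = k
        · subst hik
          rw [sum_perm_apply_eq' (fun i => E' (Matrix.single i i 1) i i) i u]
          simp [α]
        · rw [sum_perm_apply_eq (fun i k => E' (Matrix.single i i 1) k k) hik huv]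
          simp [γ, hik]
      · have : ∀ σ : Equiv.Perm d, E' (Matrix.single (σ i) (σ i) 1) (σ k) (σ l) = 0 := by
          intro σ
          apply h0
          · simp [hkl]
          · rintro ⟨h1, h2⟩
            exact hkl (σ.injective (h1.symm.trans h2))
        have h3 : ¬ (i = k ∧ i = l) := fun h => hkl (h.1.symm.trans h.2)
        simp [this, hkl, h3]
    · by_cases h2 : i = k ∧ j = l
      · obtain ⟨rfl, rfl⟩ := h2
        rw [sum_perm_apply_eq (fun i j => E' (Matrix.single i j 1) i j) hij huv]
        simp [β, hij]
      · have : ∀ σ : Equiv.Perm d, E' (Matrix.single (σ i) (σ j) 1) (σ k) (σ l) = 0 := by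
          intro σ
          apply h0
          · simp [hij]
          · simpa using h2
        simp [this, hij, h2]
  have avg : ∀ c : Equiv.Perm d → ℂ, ∀ c₀, (∀ σ, c σ = c₀) → n * ∑ σ, c σ = c₀ := by
    intro c c₀ hc
    simp only [hc, Finset.sum_const, Finset.card_univ, nsmul_eq_mul]
    rw [← mul_assoc, hn0, one_mul]
  refine ⟨_, _, _, hTs ▸ hreal, ?_, ?_, ?_⟩
  · rw [← hTs]
    simp only [fid, key, ← hf]
    simp_rw [← Finset.mul_sum]
    rw [Finset.sum_congr rfl fun i _ => Finset.sum_comm, Finset.sum_comm]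
    refine avg _ _ fun σ => ?_
    refine (Finset.sum_congr rfl fun i _ => ?_).trans (Equiv.sum_comp σ _)
    exact Equiv.sum_comp σ (fun j => E' (Matrix.single (σ i) j 1) (σ i) j)
  · rw [← hTs]
    simp only [tr, key, ← hd]
    simp_rw [← Finset.mul_sum]
    rw [Finset.sum_congr rfl fun i _ => Finset.sum_comm, Finset.sum_comm]
    refine avg _ _ fun σ => ?_
    refine (Finset.sum_congr rfl fun i _ => ?_).trans (Equiv.sum_comp σ _)
    exact Equiv.sum_comp σ (fun j => E' (Matrix.single (σ i) (σ i) 1) j j)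
  · rw [← hTs]
    simp only [diagFid, key, ← hd]
    simp_rw [← Finset.mul_sum]
    rw [Finset.sum_comm]
    refine avg _ _ fun σ => ?_
    exact Equiv.sum_comp σ (fun j => E' (Matrix.single j j 1) j j)

end Twirl

/-- One conjugation by a unitary H with entries of equal modulus replaces a full unitary twirl.
Conjugating the monomial twirl by H keeps `fid` and `tr` but changes `diagFid`. Since `fid`, `tr`
and `diagFid` determine the coefficient y of the dephasing part, a suitable mixture of the two maps,
twirled again, has y = 0. -/
theorem exists_isotropic_twirl [Nontrivial d] {E : SuperOp d d} (h : Realizable ρ E)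
    (H : Matrix d d ℂ) (hH : H.conjTranspose * H = 1)
    (hn : ∀ i j, H i j * star (H i j) = (Fintype.card d : ℂ)⁻¹) :
    ∃ x z : ℂ, Realizable ρ (symMap x 0 z) ∧ fid (symMap (d := d) x 0 z) = fid E ∧
      tr (symMap (d := d) x 0 z) = tr E := by
  obtain ⟨x, y, z, hr, hf, ht, -⟩ := exists_monomial_twirl h
  set n : ℂ := (Fintype.card d : ℂ) with hcard
  have hn0 : n ≠ 0 := Nat.cast_ne_zero.2 Fintype.card_ne_zero
  have hnp : n + 1 ≠ 0 := by
    rw [hcard]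
    exact_mod_cast Nat.succ_ne_zero (Fintype.card d)
  have hnm : n - 1 ≠ 0 := by
    rw [hcard, sub_ne_zero]
    exact_mod_cast Fintype.one_lt_card.ne'
  set C := krausMap H.conjTranspose ∘ₗ symMap x y z ∘ₗ krausMap H with hC
  have hCs : ∀ i j k l, C (Matrix.single i j 1) k l = (if i = k ∧ j = l then x else 0) +
      y * ∑ m, (H m i * star (H m j)) * (star (H m k) * H m l) +
        (if i = j ∧ k = l then z else 0) := by
    intro i j k l
    have hK : ∀ m, krausMap H (Matrix.single i j 1) m m = H m i * star (H m j) := by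
      intro m
      simp [Matrix.mul_apply, Matrix.single_apply, ite_and]
    have htr : (krausMap H (Matrix.single i j 1)).trace = if i = j then 1 else 0 := by
      rw [krausMap_apply, Matrix.trace_mul_comm, ← Matrix.mul_assoc, hH, Matrix.one_mul]
      split_ifs with hij
      · subst hij; simp
      · exact Matrix.trace_single_eq_of_ne i j (1 : ℂ) hij
    have h1 : C (Matrix.single i j 1) = x • Matrix.single i j 1 +
        y • (H.conjTranspose * Matrix.diagonal (fun m => H m i * star (H m j)) * H) +
        (z * if i = j then 1 else 0) • 1 := by
      simp only [hC, LinearMap.comp_apply, symMap, LinearMap.add_apply, LinearMap.smul_apply,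
        LinearMap.id_apply, LinearMap.smulRight_apply, Matrix.traceLinearMap_apply, htr,
        Matrix.diagonalLinearMap_apply, map_add, map_smul]
      congr 1
      · congr 1
        · congr 1
          rw [← LinearMap.comp_apply, krausMap_comp, hH]
          simp
        · congr 1
          simp only [krausMap_apply H.conjTranspose, Matrix.conjTranspose_conjTranspose]
          congr 2
          exact congrArg Matrix.diagonal (funext hK)
      · simp [hH]
    rw [h1]
    simp only [Matrix.add_apply, Matrix.smul_apply, Matrix.single_apply, smul_eq_mul,
      Matrix.one_apply, Matrix.mul_apply (M := _ * _), Matrix.mul_diagonal,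
      Matrix.conjTranspose_apply]
    congr 1
    · congr 1
      · simp
      · congr 1
        exact Finset.sum_congr rfl fun m _ => by ring
    · by_cases hij : i = j <;> by_cases hkl : k = l <;> simp [hij, hkl]
  have hCf : fid C = fid (symMap (d := d) x y z) := by
    have : ∀ i j, ∑ m, (H m i * star (H m j)) * (star (H m i) * H m j) = n⁻¹ := by
      intro i j
      have : ∀ m, (H m i * star (H m j)) * (star (H m i) * H m j) = n⁻¹ * n⁻¹ := by
        intro m
        rw [← hn m i]
        nth_rw 2 [hn m i]
        rw [← hn m j]
        ring
      simp only [this, Finset.sum_const, Finset.card_univ, nsmul_eq_mul, ← hcard]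
      field_simp
    rw [fid_symMap, fid]
    simp only [hCs, this]
    simp [Finset.sum_add_distrib, ← hcard]
    field_simp
  have hd2 : ∀ i k, ∑ m, (H m i * star (H m i)) * (star (H m k) * H m k) = n⁻¹ := by
    intro i k
    simp only [hn, mul_comm (star (H _ k)), Finset.sum_const, Finset.card_univ, nsmul_eq_mul,
      ← hcard]
    field_simp
  have hCt : tr C = tr (symMap (d := d) x y z) := by
    rw [tr_symMap, tr]
    simp only [hCs, hd2]
    simp [Finset.sum_add_distrib, ← hcard]
    field_simp
  have hCd : diagFid C = n * x + y + n * z := by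
    rw [diagFid]
    simp only [hCs, hd2]
    simp [← hcard]
    field_simp
  -- For a map `symMap x y z`, n(n − 1)y = (n + 1)`diagFid` − `fid` − `tr`. The weights 1/(n + 1)
  -- and n/(n + 1) make the right-hand side vanish for the mixture.
  have hr₁ := Realizable.sum_smul (ρ := ρ)
    (fun j : Bool => if j then ((Fintype.card d : ℝ) + 1)⁻¹
      else (Fintype.card d : ℝ) / ((Fintype.card d : ℝ) + 1))
    (by intro j; split_ifs <;> positivity)
    (by simp; field_simp; linarith) (fun j => if j then symMap x y z else C)
    (by intro j; split_ifs; exacts [hr, hr.conj H hH])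
  obtain ⟨x', y', z', hr', hf', ht', hd'⟩ := exists_monomial_twirl hr₁
  have hfE : fid (symMap (d := d) x' y' z') = fid (symMap (d := d) x y z) := by
    rw [hf']
    conv_rhs => rw [← one_mul (fid _), ← div_self hnp, add_div, add_mul]
    nth_rw 1 [← hCf]
    simp only [fid]
    simp [Finset.sum_add_distrib, Finset.mul_sum, ← hcard]
    ring
  have htE : tr (symMap (d := d) x' y' z') = tr (symMap (d := d) x y z) := by
    rw [ht']
    conv_rhs => rw [← one_mul (tr _), ← div_self hnp, add_div, add_mul]
    nth_rw 1 [← hCt]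
    simp only [tr]
    simp [Finset.sum_add_distrib, Finset.mul_sum, ← hcard]
    ring
  have hdE : diagFid (symMap (d := d) x' y' z') =
      (n + 1)⁻¹ * diagFid (symMap (d := d) x y z) + n / (n + 1) * diagFid C := by
    rw [hd']
    simp only [diagFid]
    simp [Finset.sum_add_distrib, Finset.mul_sum, ← hcard]
  have hy : y' = 0 := by
    rw [hCd] at hdE
    rw [diagFid_symMap, diagFid_symMap] at hdE
    rw [← hcard] at hdE
    have h1 := hfE
    have h2 := htE
    rw [fid_symMap, fid_symMap, ← hcard] at h1
    rw [tr_symMap, tr_symMap, ← hcard] at h2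
    field_simp at hdE
    have h1 := mul_left_cancel₀ hn0 h1
    have h2 := mul_left_cancel₀ hn0 h2
    have : (n - 1) * y' = 0 := by linear_combination hdE - h1 - h2
    exact (mul_eq_zero.1 this).resolve_left hnm
  subst hy
  exact ⟨x', z', hr', hfE.trans hf, htE.trans ht⟩

/-! ### Fidelity bounds from product Kraus operators and Cauchy–Schwarz. -/

section Bounds

/-- The superoperator from `A` to `C` that `F` implements with the resource `ρ`. -/
def implement (F : SuperOp ((d × d) × d) ((d × d) × d)) (ρ : Matrix (d × d) (d × d) ℂ) :
    SuperOp d d where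
  toFun X := traceFirst (F (withResource X ρ))
  map_add' X Y := by
    have : withResource (X + Y) ρ = withResource X ρ + withResource Y ρ := by
      simp only [withResource, Matrix.add_kronecker, Matrix.submatrix_add]; rfl
    rw [this, map_add]
    ext y y'
    simp [traceFirst, Finset.sum_add_distrib]
  map_smul' r X := by
    have : withResource (r • X) ρ = r • withResource X ρ := by
      simp only [withResource, Matrix.smul_kronecker, Matrix.submatrix_smul]; rfl
    rw [this, map_smul, traceFirst_smul]
    rfl

theorem implement_apply (F : SuperOp ((d × d) × d) ((d × d) × d)) (X : Matrix d d ℂ) :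
    implement F ρ X = traceFirst (F (withResource X ρ)) := rfl

/-- Linearity in the resource carries the product-state bound to the convex hull, and then to an
arbitrary resource through its robustness decomposition. -/
theorem isLinearMap_fid_implement (F : SuperOp ((d × d) × d) ((d × d) × d)) :
    IsLinearMap ℝ fun ρ => (fid (implement F ρ)).re where
  map_add ρ ρ' := by
    have : ∀ X : Matrix d d ℂ, withResource X (ρ + ρ') = withResource X ρ + withResource X ρ' := by
      intro X
      simp only [withResource, Matrix.kronecker_add, Matrix.submatrix_add]; rfl
    simp [fid, implement_apply, this, traceFirst, Finset.sum_add_distrib]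
  map_smul r ρ := by
    have : ∀ X : Matrix d d ℂ, withResource X (r • ρ) = (r : ℂ) • withResource X ρ := by
      intro X
      ext p q
      simp [withResource, Matrix.kroneckerMap_apply]
      ring
    simp only [fid, implement_apply, this, map_smul, traceFirst_smul, Matrix.smul_apply,
      ← Finset.smul_sum]
    simp

/-- `1 ⊗ S`, with the first two tensor factors of the target grouped together. -/
def extendOne {s : Type} (S : Matrix (d × d) s ℂ) : Matrix ((d × d) × d) (d × s) ℂ :=
  ((1 : Matrix d d ℂ) ⊗ₖ S).submatrix (Equiv.prodAssoc d d d) id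

/-- Factoring the resource as S S† writes the input as (1 ⊗ S)(|i⟩⟨j| ⊗ 1)(1 ⊗ S)†. Output entries
become Gram sums, so that `fid` and `tr` are sums of squared moduli. -/
theorem traceFirst_krausMap_withResource {s : Type} [Fintype s]
    (L : Matrix ((d × d) × d) ((d × d) × d) ℂ) (S : Matrix (d × d) s ℂ) (i j k l : d) :
    traceFirst (krausMap L (withResource (Matrix.single i j 1) (S * S.conjTranspose))) k l =
      ∑ x, ∑ t, (L * extendOne S) (x, k) (i, t) * star ((L * extendOne S) (x, l) (j, t)) := by
  classical
  have h : withResource (Matrix.single i j 1) (S * S.conjTranspose) =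
      extendOne S * (Matrix.single i j 1 ⊗ₖ (1 : Matrix s s ℂ)) * (extendOne S).conjTranspose := by
    have hid : (Matrix.single i j (1 : ℂ) ⊗ₖ (1 : Matrix s s ℂ)) =
        (Matrix.single i j 1 ⊗ₖ (1 : Matrix s s ℂ)).submatrix (Equiv.refl _) (Equiv.refl _) := rfl
    have hS : extendOne S = ((1 : Matrix d d ℂ) ⊗ₖ S).submatrix (Equiv.prodAssoc d d d)
      (Equiv.refl (d × s)) := rfl
    rw [hid, hS, Matrix.conjTranspose_submatrix, Matrix.submatrix_mul_equiv,
      Matrix.submatrix_mul_equiv, Matrix.conjTranspose_kronecker, ← Matrix.mul_kronecker_mul,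
      ← Matrix.mul_kronecker_mul]
    simp [withResource]
  have h' : krausMap L (withResource (Matrix.single i j 1) (S * S.conjTranspose)) =
      (L * extendOne S) * (Matrix.single i j 1 ⊗ₖ (1 : Matrix s s ℂ)) *
        (L * extendOne S).conjTranspose := by
    rw [h, krausMap_apply, Matrix.conjTranspose_mul]
    simp only [Matrix.mul_assoc]
  simp only [traceFirst, Matrix.of_apply, h']
  refine Finset.sum_congr rfl fun x _ => ?_
  generalize L * extendOne S = M
  rw [Matrix.mul_apply, Fintype.sum_prod_type, Finset.sum_eq_single j]
  · refine Finset.sum_congr rfl fun t _ => ?_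
    rw [Matrix.mul_apply, Fintype.sum_prod_type, Finset.sum_eq_single i]
    · simp [Matrix.kroneckerMap_apply, Matrix.one_apply]
    · intro b _ hb
      simp [Matrix.kroneckerMap_apply, hb.symm]
    · simp
  · intro b _ hb
    refine Finset.sum_eq_zero fun t _ => ?_
    rw [Matrix.mul_apply]
    simp [Matrix.kroneckerMap_apply, hb.symm]
  · simp

/-- The fidelity and the trace of an implemented superoperator, in terms of Kraus operators. -/
theorem fid_tr_implement {ι s : Type} [Fintype ι] [Fintype s]
    (L : ι → Matrix ((d × d) × d) ((d × d) × d) ℂ) (S : Matrix (d × d) s ℂ) :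
    fid (implement (∑ j, krausMap (L j)) (S * S.conjTranspose)) =
        ((∑ j, ∑ x, ∑ t, ‖∑ i, (L j * extendOne S) (x, i) (i, t)‖ ^ 2 : ℝ) : ℂ) ∧
      tr (implement (∑ j, krausMap (L j)) (S * S.conjTranspose)) =
        ((∑ j, ∑ x, ∑ t, ∑ i, ∑ k, ‖(L j * extendOne S) (x, k) (i, t)‖ ^ 2 : ℝ) : ℂ) := by
  have hentry : ∀ i j k l, implement (∑ j, krausMap (L j)) (S * S.conjTranspose)
      (Matrix.single i j 1) k l = ∑ u, ∑ x, ∑ t, (L u * extendOne S) (x, k) (i, t) *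
        star ((L u * extendOne S) (x, l) (j, t)) := by
    intro i j k l
    rw [implement_apply, LinearMap.sum_apply, traceFirst_sum, Matrix.sum_apply]
    exact Finset.sum_congr rfl fun u _ => traceFirst_krausMap_withResource (L u) S i j k l
  have hn : ∀ z : ℂ, ((‖z‖ ^ 2 : ℝ) : ℂ) = z * star z := by
    intro z
    rw [Complex.star_def, Complex.mul_conj']
    push_cast
    rfl
  have hc : ∀ f : d → d → ι → (d × d) → s → ℂ, ∑ i, ∑ j, ∑ u, ∑ x, ∑ t, f i j u x t =
      ∑ u, ∑ x, ∑ t, ∑ i, ∑ j, f i j u x t := by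
    intro f
    have h₁ : ∑ p : d × d, ∑ q : ι × (d × d) × s, f p.1 p.2 q.1 q.2.1 q.2.2 =
        ∑ i, ∑ j, ∑ u, ∑ x, ∑ t, f i j u x t := by simp only [Fintype.sum_prod_type]
    have h₂ : ∑ q : ι × (d × d) × s, ∑ p : d × d, f p.1 p.2 q.1 q.2.1 q.2.2 =
        ∑ u, ∑ x, ∑ t, ∑ i, ∑ j, f i j u x t := by simp only [Fintype.sum_prod_type]
    rw [← h₁, ← h₂, Finset.sum_comm]
  constructor
  · simp only [fid, hentry]
    rw [hc]
    push_cast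
    refine Finset.sum_congr rfl fun u _ => Finset.sum_congr rfl fun x _ =>
      Finset.sum_congr rfl fun t _ => ?_
    have := hn (∑ i, (L u * extendOne S) (x, i) (i, t))
    push_cast at this
    rw [this, star_sum, Finset.sum_mul_sum]
  · simp only [tr, hentry]
    rw [hc]
    push_cast
    refine Finset.sum_congr rfl fun u _ => Finset.sum_congr rfl fun x _ =>
      Finset.sum_congr rfl fun t _ => Finset.sum_congr rfl fun i _ =>
      Finset.sum_congr rfl fun k _ => ?_
    have := hn ((L u * extendOne S) (x, k) (i, t))
    push_cast at this
    rw [this]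

theorem sum_norm_sq_eq_trace {m n : Type} [Fintype m] [Fintype n] (M : Matrix m n ℂ) :
    ((∑ q, ∑ p, ‖M p q‖ ^ 2 : ℝ) : ℂ) = (M.conjTranspose * M).trace := by
  simp only [Matrix.trace, Matrix.diag_apply, Matrix.mul_apply, Matrix.conjTranspose_apply]
  push_cast
  refine Finset.sum_congr rfl fun q _ => Finset.sum_congr rfl fun p _ => ?_
  rw [Complex.star_def, Complex.conj_mul']

/-- With V = 1 ⊗ S the sum is Tr V†(∑ L†L)V, at most Tr V†V = n · Tr S S† = n. -/
theorem sum_norm_sq_kraus_le {ι s : Type} [Fintype ι] [Fintype s]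
    (L : ι → Matrix ((d × d) × d) ((d × d) × d) ℂ)
    (hL : (1 - ∑ j, (L j).conjTranspose * L j).PosSemidef) (S : Matrix (d × d) s ℂ)
    (hS : (S * S.conjTranspose).trace = 1) :
    ∑ j, ∑ x, ∑ t, ∑ i, ∑ k, ‖(L j * extendOne S) (x, k) (i, t)‖ ^ 2 ≤ (Fintype.card d : ℝ) := by
  have h₁ : ((∑ j, ∑ x, ∑ t, ∑ i, ∑ k, ‖(L j * extendOne S) (x, k) (i, t)‖ ^ 2 : ℝ) : ℂ) =
      ∑ j, ((L j * extendOne S).conjTranspose * (L j * extendOne S)).trace := by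
    rw [Complex.ofReal_sum]
    refine Finset.sum_congr rfl fun j _ => ?_
    rw [← sum_norm_sq_eq_trace]
    congr 1
    have hc : ∀ g : d × d → s → d → ℝ, ∑ x, ∑ t, ∑ i, g x t i = ∑ i, ∑ t, ∑ x, g x t i :=
      fun g => Finset.sum_comm.trans
        ((Finset.sum_congr rfl fun t _ => Finset.sum_comm).trans Finset.sum_comm)
    rw [hc]
    simp only [Fintype.sum_prod_type]
  have h₂ := (hL.conjTranspose_mul_mul_same (extendOne S)).trace_nonneg
  have h₃ : ((extendOne S).conjTranspose * extendOne S).trace = (Fintype.card d : ℂ) := by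
    have : (extendOne S).conjTranspose * extendOne S =
        (1 : Matrix d d ℂ) ⊗ₖ (S.conjTranspose * S) := by
      rw [extendOne, Matrix.conjTranspose_submatrix, Matrix.submatrix_mul_equiv,
        Matrix.conjTranspose_kronecker, ← Matrix.mul_kronecker_mul]
      simp
    rw [this, Matrix.trace_kronecker, Matrix.trace_mul_comm, hS]
    simp
  rw [Matrix.mul_sub, Matrix.sub_mul, Matrix.trace_sub, Matrix.mul_one, h₃, sub_nonneg] at h₂
  have h₄ : ((extendOne S).conjTranspose * (∑ j, (L j).conjTranspose * L j) * extendOne S).trace =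
      ∑ j, ((L j * extendOne S).conjTranspose * (L j * extendOne S)).trace := by
    rw [Matrix.mul_sum, Matrix.sum_mul, Matrix.trace_sum]
    simp only [Matrix.conjTranspose_mul, Matrix.mul_assoc]
  rw [h₄, ← h₁] at h₂
  exact_mod_cast h₂

open scoped MatrixOrder in
theorem exists_eq_mul_conjTranspose {n : Type} [Fintype n] {A : Matrix n n ℂ}
    (h : A.PosSemidef) : ∃ S : Matrix n n ℂ, A = S * S.conjTranspose := by
  classical
  obtain ⟨B, hB⟩ := CStarAlgebra.nonneg_iff_eq_star_mul_self.1 h.nonneg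
  exact ⟨B.conjTranspose, by rwa [Matrix.conjTranspose_conjTranspose]⟩

/-- Both quantities are sums of squares, hence real. Cauchy–Schwarz over the n diagonal terms bounds
the fidelity by n times the trace, and trace non-increase bounds the trace. -/
theorem IsLOCC.fid_tr_bounds {F : SuperOp ((d × d) × d) ((d × d) × d)} (hF : IsLOCC (d × d) d F)
    (hρ : IsDensity ρ) : ∃ f t : ℝ, fid (implement F ρ) = f ∧ tr (implement F ρ) = t ∧ 0 ≤ f ∧
      f ≤ Fintype.card d * t ∧ t ≤ Fintype.card d := by
  obtain ⟨ι, _, P, Q, rfl, hL⟩ := hF.exists_kraus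
  obtain ⟨S, rfl⟩ := exists_eq_mul_conjTranspose hρ.1
  obtain ⟨h₁, h₂⟩ := fid_tr_implement (fun j => P j ⊗ₖ Q j) S
  refine ⟨_, _, h₁, h₂, by positivity, ?_, sum_norm_sq_kraus_le _ hL S hρ.2⟩
  rw [Finset.mul_sum]
  refine Finset.sum_le_sum fun j _ => ?_
  rw [Finset.mul_sum]
  refine Finset.sum_le_sum fun x _ => ?_
  rw [Finset.mul_sum]
  refine Finset.sum_le_sum fun t _ => ?_
  generalize P j ⊗ₖ Q j * extendOne S = M
  calc ‖∑ i, M (x, i) (i, t)‖ ^ 2 ≤ (∑ i, ‖M (x, i) (i, t)‖) ^ 2 := by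
        gcongr; exact norm_sum_le _ _
    _ ≤ Fintype.card d * ∑ i, ‖M (x, i) (i, t)‖ ^ 2 := by
        simpa using sq_sum_le_card_mul_sum_sq (s := Finset.univ) (f := fun i => ‖M (x, i) (i, t)‖)
    _ ≤ _ := by
        gcongr with i
        exact Finset.single_le_sum (f := fun k => ‖M (x, k) (i, t)‖ ^ 2)
          (fun k _ => by positivity) (Finset.mem_univ i)

/-- With a product state as resource, the implemented superoperator is entanglement breaking, so
that its entanglement fidelity is at most the inverse of the dimension. -/
theorem IsLOCC.fid_product_le {F : SuperOp ((d × d) × d) ((d × d) × d)} (hF : IsLOCC (d × d) d F)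
    {σ τ : Matrix d d ℂ} (hσ : IsDensity σ) (hτ : IsDensity τ) :
    (fid (implement F (σ ⊗ₖ τ))).re ≤ Fintype.card d := by
  obtain ⟨ι, _, P, Q, rfl, hL⟩ := hF.exists_kraus
  have htr : (σ ⊗ₖ τ).trace = 1 := by rw [Matrix.trace_kronecker, hσ.2, hτ.2, one_mul]
  obtain ⟨S, rfl⟩ := exists_eq_mul_conjTranspose hσ.1
  obtain ⟨T, rfl⟩ := exists_eq_mul_conjTranspose hτ.1
  have hST : (S * S.conjTranspose) ⊗ₖ (T * T.conjTranspose) =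
      (S ⊗ₖ T) * (S ⊗ₖ T).conjTranspose := by
    rw [Matrix.conjTranspose_kronecker, Matrix.mul_kronecker_mul]
  rw [hST] at htr ⊢
  rw [(fid_tr_implement (fun j => P j ⊗ₖ Q j) (S ⊗ₖ T)).1, Complex.ofReal_re]
  refine le_trans ?_ (sum_norm_sq_kraus_le _ hL (S ⊗ₖ T) htr)
  refine Finset.sum_le_sum fun j _ => Finset.sum_le_sum fun x _ => Finset.sum_le_sum fun t _ => ?_
  -- For a product resource the Kraus entries factor into an input part and an output part.
  -- Cauchy–Schwarz then bounds the fidelity by the trace itself, without the factor n.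
  have hM : ∀ k i, (P j ⊗ₖ Q j * extendOne (S ⊗ₖ T)) (x, k) (i, t) =
      (P j * ((1 : Matrix d d ℂ) ⊗ₖ S)) x (i, t.1) * (Q j * T) k t.2 := by
    have : extendOne (S ⊗ₖ T) = ((((1 : Matrix d d ℂ) ⊗ₖ S) ⊗ₖ T).submatrix id
        (Equiv.prodAssoc d d d).symm) := by
      ext ⟨⟨p, q⟩, r⟩ ⟨p', q', r'⟩
      simp [extendOne, Matrix.kroneckerMap_apply, mul_assoc]
    intro k i
    rw [this]
    change ((P j ⊗ₖ Q j) * (((1 : Matrix d d ℂ) ⊗ₖ S) ⊗ₖ T)) (x, k) ((i, t.1), t.2) = _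
    rw [← Matrix.mul_kronecker_mul]
    rfl
  simp only [hM, norm_mul, mul_pow]
  generalize (P j * ((1 : Matrix d d ℂ) ⊗ₖ S)) x = p
  generalize Q j * T = q
  calc ‖∑ i, p (i, t.1) * q i t.2‖ ^ 2 ≤ (∑ i, ‖p (i, t.1)‖ * ‖q i t.2‖) ^ 2 := by
        gcongr
        refine (norm_sum_le _ _).trans (le_of_eq ?_)
        simp
    _ ≤ (∑ i, ‖p (i, t.1)‖ ^ 2) * ∑ k, ‖q k t.2‖ ^ 2 := Finset.sum_mul_sq_le_sq_mul_sq _ _ _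
    _ = _ := Finset.sum_mul_sum _ _ _ _

theorem IsLOCC.fid_separable_le {F : SuperOp ((d × d) × d) ((d × d) × d)}
    (hF : IsLOCC (d × d) d F) {σ : Matrix (d × d) (d × d) ℂ} (hσ : σ ∈ separableStates d d) :
    (fid (implement F σ)).re ≤ Fintype.card d := by
  have : separableStates d d ⊆ {σ | (fid (implement F σ)).re ≤ Fintype.card d} := by
    refine convexHull_min ?_ (convex_halfSpace_le (isLinearMap_fid_implement F) _)
    rintro _ ⟨σ, τ, hσ, hτ, rfl⟩
    exact hF.fid_product_le hσ hτ
  exact this hσ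

/-- Write ρ = (1 + l)σ − lω with σ separable. The term in ω can be dropped because its fidelity is
nonnegative. -/
theorem IsLOCC.fid_le {F : SuperOp ((d × d) × d) ((d × d) × d)} (hF : IsLOCC (d × d) d F)
    {l : ℝ} (hl : 0 ≤ l) {ω : Matrix (d × d) (d × d) ℂ} (hω : IsDensity ω)
    (h : (1 + l)⁻¹ • (ρ + l • ω) ∈ separableStates d d) :
    (fid (implement F ρ)).re ≤ (1 + l) * Fintype.card d := by
  have h₁ := hF.fid_separable_le h
  have hlin := isLinearMap_fid_implement F
  obtain ⟨f, -, hf, -, hf0, -⟩ := hF.fid_tr_bounds hω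
  rw [hlin.map_smul, hlin.map_add, hlin.map_smul, hf, Complex.ofReal_re, smul_eq_mul,
    inv_mul_le_iff₀ (by positivity), smul_eq_mul] at h₁
  nlinarith [mul_nonneg hl hf0]

end Bounds

/-! ### Equivalence of wire cuts and operations of large fidelity. -/

section Cut

open scoped MatrixOrder in
/-- A superoperator that fixes all density operators is the identity. -/
theorem eq_id_of_forall_isDensity {V : SuperOp d d} (h : ∀ φ, IsDensity φ → V φ = φ) :
    V = LinearMap.id := by
  refine LinearMap.ext_on (s := {A : Matrix d d ℂ | 0 ≤ A}) CStarAlgebra.span_nonneg fun A hA => ?_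
  have hA : A.PosSemidef := Matrix.nonneg_iff_posSemidef.1 hA
  by_cases h0 : A.trace = 0
  · rw [hA.trace_eq_zero_iff] at h0
    simp [h0]
  · have hd : IsDensity (A.trace⁻¹ • A) := by
      refine ⟨hA.smul ?_, ?_⟩
      · exact inv_nonneg.2 hA.trace_nonneg
      · rw [Matrix.trace_smul, smul_eq_mul, inv_mul_cancel₀ h0]
    have := congrArg (A.trace • ·) (h _ hd)
    simpa [smul_smul, h0] using this

theorem fid_sum_smul {ι : Type} (s : Finset ι) (c : ι → ℂ) (E : ι → SuperOp d d) :
    fid (∑ j ∈ s, c j • E j) = ∑ j ∈ s, c j * fid (E j) := by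
  simp only [fid, LinearMap.sum_apply, LinearMap.smul_apply, Matrix.sum_apply, Matrix.smul_apply,
    smul_eq_mul, Finset.mul_sum]
  rw [Finset.sum_comm]
  refine (Finset.sum_congr rfl fun i _ => Finset.sum_comm).trans ?_
  rw [Finset.sum_comm]
  refine Finset.sum_congr rfl fun i _ => Finset.sum_comm

theorem fid_id : fid (LinearMap.id : SuperOp d d) = (Fintype.card d : ℂ) ^ 2 := by
  simp [fid, sq]

theorem implement_sum_smul {ι : Type} (s : Finset ι) (c : ι → ℂ)
    (F : ι → SuperOp ((d × d) × d) ((d × d) × d)) :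
    implement (∑ j ∈ s, c j • F j) ρ = ∑ j ∈ s, c j • implement (F j) ρ := by
  ext1 X
  simp only [implement_apply, LinearMap.sum_apply, LinearMap.smul_apply, traceFirst_sum,
    traceFirst_smul]

theorem realizable_implement {F : SuperOp ((d × d) × d) ((d × d) × d)} (hF : IsLOCC (d × d) d F) :
    Realizable ρ (implement F ρ) := ⟨F, hF, fun _ => rfl⟩

theorem Realizable.exists_implement {E : SuperOp d d} (h : Realizable ρ E) :
    ∃ F, IsLOCC (d × d) d F ∧ E = implement F ρ := by
  obtain ⟨F, hF, hE⟩ := h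
  exact ⟨F, hF, LinearMap.ext hE⟩

/-- A wire cut contains an operation of large fidelity. -/
theorem IsWireCut.exists_fid [Nonempty d] (hρ : IsDensity ρ) {N : ℕ} {c : Fin N → ℝ}
    {F : Fin N → SuperOp ((d × d) × d) ((d × d) × d)} (h : IsWireCut ρ c F) :
    ∃ i, (Fintype.card d : ℝ) ^ 2 ≤ (∑ i, |c i| + 1) / 2 * (fid (implement (F i) ρ)).re := by
  obtain ⟨hF, hc, hV⟩ := h
  have hid : ∑ i, (c i : ℂ) • implement (F i) ρ = LinearMap.id := by
    rw [← implement_sum_smul]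
    exact eq_id_of_forall_isDensity hV
  have hsum := congrArg (fun E => (fid E).re) hid
  simp only [fid_sum_smul, fid_id, Complex.re_sum, Complex.re_ofReal_mul] at hsum
  have hsq : ((Fintype.card d : ℂ) ^ 2).re = (Fintype.card d : ℝ) ^ 2 := by
    rw [← Complex.ofReal_natCast, ← Complex.ofReal_pow, Complex.ofReal_re]
  rw [hsq] at hsum
  have hN : (Finset.univ : Finset (Fin N)).Nonempty := by
    by_contra hne
    rw [Finset.not_nonempty_iff_eq_empty] at hne
    rw [hne] at hc
    simp at hc
  obtain ⟨i, -, hi⟩ := Finset.exists_max_image Finset.univ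
    (fun i => (fid (implement (F i) ρ)).re) hN
  refine ⟨i, ?_⟩
  -- Since the coefficients sum to 1, (∑|c| + 1)/2 is the sum of their positive parts. Fidelities
  -- being nonnegative, replacing c by its positive part and each fidelity by the largest only
  -- increases the sum.
  have hP : (∑ i, |c i| + 1) / 2 = ∑ i, (|c i| + c i) / 2 := by
    rw [← hc, ← Finset.sum_add_distrib, Finset.sum_div]
  rw [hP, ← hsum, Finset.sum_mul]
  refine Finset.sum_le_sum fun j _ => ?_
  obtain ⟨f, -, hf, -, hf0, -⟩ := (hF j).fid_tr_bounds hρ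
  have h1 : 0 ≤ (fid (implement (F j) ρ)).re := by rw [hf]; exact hf0
  have h2 := hi j (Finset.mem_univ j)
  have h3 : c j ≤ (|c j| + c j) / 2 := by linarith [le_abs_self (c j)]
  have h4 : 0 ≤ (|c j| + c j) / 2 := by linarith [neg_abs_le (c j)]
  calc _ ≤ (|c j| + c j) / 2 * (fid (implement (F j) ρ)).re := by gcongr
    _ ≤ _ := by gcongr

theorem measurePrepare_single (g : d → d) (i j k l : d) :
    measurePrepare g (Matrix.single i j 1) k l =
      if i = j ∧ g i = k ∧ g i = l then (1 : ℂ) else 0 := by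
  simp only [measurePrepare, LinearMap.coe_mk, AddHom.coe_mk, Matrix.sum_apply, Matrix.smul_apply,
    smul_eq_mul]
  rw [Finset.sum_eq_single i]
  · simp only [Matrix.single_apply, true_and, ← ite_and, mul_ite, mul_one, mul_zero]
    by_cases hij : i = j <;> simp [hij, eq_comm]
  · intro m _ hm
    simp [Matrix.single_apply, hm.symm]
  · simp

theorem fid_measurePrepare (g : d → d) :
    fid (measurePrepare g) = ∑ i, if g i = i then (1 : ℂ) else 0 := by
  simp only [fid, measurePrepare_single]
  refine Finset.sum_congr rfl fun i _ => ?_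
  rw [Finset.sum_eq_single i]
  · simp
  · intro j _ hj
    simp [hj.symm]
  · simp

theorem tr_measurePrepare (g : d → d) : tr (measurePrepare g) = Fintype.card d := by
  simp [tr, measurePrepare_single]

theorem symMap_apply (x z : ℂ) (X : Matrix d d ℂ) :
    symMap x 0 z X = x • X + (z * X.trace) • 1 := by
  simp [symMap, smul_smul]

/-- An operation of fidelity `f` yields a wire cut of overhead `2 / f - 1`. -/
theorem exists_isWireCut [Nontrivial d] (hρ : IsDensity ρ) (H : Matrix d d ℂ)
    (hH : H.conjTranspose * H = 1)
    (hn : ∀ i j, H i j * star (H i j) = (Fintype.card d : ℂ)⁻¹)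
    {E : SuperOp d d} (hE : Realizable ρ E) {f : ℝ} (hf : 0 < f)
    (hfE : (fid E).re = (Fintype.card d : ℝ) ^ 2 * f) :
    ∃ (N : ℕ) (c : Fin N → ℝ) (F : Fin N → SuperOp ((d × d) × d) ((d × d) × d)),
      IsWireCut ρ c F ∧ 2 / f - 1 = ∑ i, |c i| := by
  have hn1 : (1 : ℝ) < Fintype.card d := by exact_mod_cast Fintype.one_lt_card
  obtain ⟨f', t, hf', ht, -, hft, htn⟩ : ∃ f' t : ℝ, fid E = f' ∧ tr E = t ∧ 0 ≤ f' ∧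
      f' ≤ Fintype.card d * t ∧ t ≤ Fintype.card d := by
    obtain ⟨F, hF, rfl⟩ := hE.exists_implement
    exact hF.fid_tr_bounds hρ
  rw [hf', Complex.ofReal_re] at hfE
  subst hfE
  set n : ℝ := (Fintype.card d : ℝ) with hcard
  have hn0 : 0 < n := by linarith
  -- s is the weight of the error part of E: the twirled E will be f · id + s · N.
  set s : ℝ := t / n - f with hs
  have hts : t = n * (f + s) := by rw [hs]; field_simp; ring
  have hs0 : 0 ≤ s := by
    rw [hts] at hft
    by_contra hneg
    push Not at hneg
    nlinarith [mul_pos hn0 hn0]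
  have hs1 : s ≤ 1 - f := by
    rw [hts] at htn
    nlinarith
  -- If f = 1 then s = 0, and the convention 0/0 = 0 is harmless.
  have hcoef : (1 / f - 1) * (s / (1 - f)) = s / f := by
    by_cases h1 : 1 - f = 0
    · have : s = 0 := by linarith
      simp [this]
    · field_simp
  -- A fixed-point-free g makes measure-and-prepare have fidelity 0 and full trace. Its twirl is
  -- N(X) = (n Tr(X) 1 − X)/(n² − 1).
  obtain ⟨g, hg⟩ : ∃ g : d → d, ∀ i, g i ≠ i := ⟨fun i => (exists_ne i).choose,
    fun i => (exists_ne i).choose_spec⟩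
  obtain ⟨x, z, hr, hxz, hxz'⟩ := exists_isotropic_twirl hE H hH hn
  obtain ⟨x₀, z₀, hr₀, hxz₀, hxz₀'⟩ :=
    exists_isotropic_twirl (realizable_measurePrepare hρ.2 g) H hH hn
  obtain ⟨F₁, hF₁, hF₁'⟩ := hr
  -- Subtracting (s/f) N directly would spoil the sum of the coefficients. Instead, outcomes are
  -- discarded to rescale N by s/(1 − f) ≤ 1, so that its coefficient becomes −(1/f − 1).
  obtain ⟨F₂, hF₂, hF₂'⟩ := Realizable.sum_smul (ρ := ρ) (fun _ : Unit => s / (1 - f))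
    (fun _ => div_nonneg hs0 (hs0.trans hs1)) (by simpa using div_le_one_of_le₀ hs1 (hs0.trans hs1))
    _ (fun _ => hr₀)
  rw [fid_symMap, hf', ← Complex.ofReal_natCast, ← hcard] at hxz
  rw [tr_symMap, ht, hts, ← Complex.ofReal_natCast, ← hcard] at hxz'
  rw [fid_symMap, fid_measurePrepare, ← Complex.ofReal_natCast, ← hcard] at hxz₀
  rw [tr_symMap, tr_measurePrepare, ← Complex.ofReal_natCast, ← hcard] at hxz₀'
  have hnC : (n : ℂ) ≠ 0 := by exact_mod_cast hn0.ne'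
  have hn2 : (n : ℂ) ^ 2 - 1 ≠ 0 := by
    have : n ^ 2 - 1 ≠ 0 := by nlinarith
    exact_mod_cast this
  simp only [hg, if_false, Finset.sum_const_zero] at hxz₀
  push_cast at hxz hxz'
  have e1 : n * x + z = n * f := mul_left_cancel₀ hnC (by linear_combination hxz)
  have e2 : x + n * z = f + s := mul_left_cancel₀ hnC (by linear_combination hxz')
  have e3 : n * x₀ + z₀ = 0 := mul_left_cancel₀ hnC (by linear_combination hxz₀)
  have e4 : x₀ + n * z₀ = 1 := mul_left_cancel₀ hnC (by linear_combination hxz₀')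
  have hx : x = f + s * x₀ := mul_left_cancel₀ hn2 (by
    linear_combination (n : ℂ) * e1 - e2 - s * n * e3 + s * e4)
  have hz : z = s * z₀ := by linear_combination e1 - n * hx - s * e3
  refine ⟨2, ![1 / f, -(1 / f - 1)], ![F₁, F₂], ⟨?_, ?_, ?_⟩, ?_⟩
  · intro i
    fin_cases i
    exacts [hF₁, hF₂]
  · simp
  · intro φ hφ
    have h₂ : traceFirst (F₂ (withResource φ ρ)) = ((s / (1 - f) : ℝ) : ℂ) • symMap x₀ 0 z₀ φ := by
      rw [← hF₂']
      simp
    have h₁ : (∑ i, ((![1 / f, -(1 / f - 1)] i : ℝ) : ℂ) • (![F₁, F₂] i))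
        (withResource φ ρ) = ∑ i, ((![1 / f, -(1 / f - 1)] i : ℝ) : ℂ) •
          (![F₁, F₂] i) (withResource φ ρ) := by
      simp only [LinearMap.sum_apply, LinearMap.smul_apply]
    rw [h₁, traceFirst_sum]
    simp only [traceFirst_smul, Fin.sum_univ_two, Matrix.cons_val_zero, Matrix.cons_val_one]
    rw [h₂, ← hF₁', smul_smul, ← Complex.ofReal_mul, neg_mul, hcoef, symMap_apply, symMap_apply,
      hφ.2, hx, hz]
    have hfC : (f : ℂ) ≠ 0 := by exact_mod_cast hf.ne'
    ext i j
    simp only [Matrix.add_apply, Matrix.smul_apply, smul_eq_mul]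
    push_cast
    field_simp
    ring
  · have h1f : 1 ≤ 1 / f := by
      rw [le_div_iff₀ hf]
      linarith
    rw [Fin.sum_univ_two]
    simp only [Matrix.cons_val_zero, Matrix.cons_val_one]
    rw [abs_neg, abs_of_nonneg (by linarith), abs_of_nonneg (by linarith)]
    ring

end Cut

/-! ### Bounds on the overhead, and the Hadamard transform used for twirling. -/

section Overhead

/-- For A = S S† with Frobenius norm of S equal to 1, Cauchy–Schwarz gives ‖S†x‖ ≤ ‖x‖. This makes 1
− ρ usable as the noise in a robustness decomposition. -/
theorem IsDensity.posSemidef_one_sub {n : Type} [Fintype n] [DecidableEq n] {A : Matrix n n ℂ}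
    (h : IsDensity A) : (1 - A).PosSemidef := by
  obtain ⟨S, rfl⟩ := exists_eq_mul_conjTranspose h.1
  have htr : ∑ q, ∑ p, ‖S p q‖ ^ 2 = 1 := by
    have := sum_norm_sq_eq_trace S
    rw [Matrix.trace_mul_comm, h.2] at this
    exact_mod_cast this
  have hdot : ∀ {m : Type} [Fintype m] (v : m → ℂ), star v ⬝ᵥ v = ((∑ p, ‖v p‖ ^ 2 : ℝ) : ℂ) := by
    intro m _ v
    simp only [dotProduct, Pi.star_apply]
    push_cast
    exact Finset.sum_congr rfl fun p _ => by rw [Complex.star_def, Complex.conj_mul']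
  refine Matrix.PosSemidef.of_dotProduct_mulVec_nonneg
    (Matrix.isHermitian_one.sub h.1.isHermitian) fun x => ?_
  have h₁ : star x ⬝ᵥ ((S * S.conjTranspose) *ᵥ x) =
      star (S.conjTranspose *ᵥ x) ⬝ᵥ (S.conjTranspose *ᵥ x) := by
    rw [← Matrix.mulVec_mulVec, Matrix.dotProduct_mulVec, Matrix.star_mulVec,
      Matrix.conjTranspose_conjTranspose]
  rw [Matrix.sub_mulVec, dotProduct_sub, Matrix.one_mulVec, h₁, hdot, hdot, sub_nonneg]
  norm_cast
  calc ∑ q, ‖(S.conjTranspose *ᵥ x) q‖ ^ 2 ≤ ∑ q, (∑ p, ‖S p q‖ ^ 2) * ∑ p, ‖x p‖ ^ 2 := by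
        refine Finset.sum_le_sum fun q _ => ?_
        refine le_trans ?_ (Finset.sum_mul_sq_le_sq_mul_sq _ _ _)
        gcongr
        refine (norm_sum_le _ _).trans (le_of_eq ?_)
        simp
    _ = ∑ p, ‖x p‖ ^ 2 := by rw [← Finset.sum_mul, htr, one_mul]

theorem IsDensity.maximallyMixed {n : Type} [Fintype n] [DecidableEq n] [Nonempty n] :
    IsDensity ((Fintype.card n : ℂ)⁻¹ • (1 : Matrix n n ℂ)) := by
  refine ⟨Matrix.PosSemidef.one.smul (inv_nonneg.2 (Nat.cast_nonneg _)), ?_⟩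
  simp

/-- The generalized robustness of a state is finite. -/
theorem robustness_set_nonempty [Nontrivial d] (hρ : IsDensity ρ) :
    {l : ℝ | 0 ≤ l ∧ ∃ ω : Matrix (d × d) (d × d) ℂ, IsDensity ω ∧
      (1 + l)⁻¹ • (ρ + l • ω) ∈ separableStates d d}.Nonempty := by
  have hn1 : (1 : ℝ) < Fintype.card d := by exact_mod_cast Fintype.one_lt_card
  set n : ℝ := (Fintype.card d : ℝ) with hcard
  have hl : 0 < n ^ 2 - 1 := by nlinarith
  -- Mixing ρ with the normalized 1 − ρ in this proportion gives the maximally mixed state, a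
  -- product state.
  refine ⟨n ^ 2 - 1, hl.le, ((n ^ 2 - 1)⁻¹ : ℝ) • (1 - ρ),
    ⟨hρ.posSemidef_one_sub.smul (inv_nonneg.2 hl.le), ?_⟩, ?_⟩
  · rw [Matrix.trace_smul, Matrix.trace_sub, hρ.2, Matrix.trace_one, Fintype.card_prod]
    have : ((Fintype.card d * Fintype.card d : ℕ) : ℂ) - 1 = ((n ^ 2 - 1 : ℝ) : ℂ) := by
      rw [hcard]
      push_cast
      ring
    rw [this, Complex.real_smul, ← Complex.ofReal_mul, inv_mul_cancel₀ hl.ne', Complex.ofReal_one]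
  · rw [smul_smul, mul_inv_cancel₀ hl.ne', one_smul, add_sub_cancel, add_sub_cancel]
    refine subset_convexHull ℝ _ ⟨_, _, IsDensity.maximallyMixed, IsDensity.maximallyMixed, ?_⟩
    rw [Matrix.smul_kronecker, Matrix.kronecker_smul, Matrix.one_kronecker_one, smul_smul]
    ext p q
    simp [hcard, sq]

/-- Measuring and re-preparing in the computational basis has f = 1/n and gives a cut whatever the
resource. Nonemptiness matters because `sInf ∅ = 0`. -/
theorem overhead_set_nonempty [Nontrivial d] (hρ : IsDensity ρ) (H : Matrix d d ℂ)
    (hH : H.conjTranspose * H = 1)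
    (hn : ∀ i j, H i j * star (H i j) = (Fintype.card d : ℂ)⁻¹) :
    {κ : ℝ | ∃ (N : ℕ) (c : Fin N → ℝ) (F : Fin N → SuperOp ((d × d) × d) ((d × d) × d)),
      IsWireCut ρ c F ∧ κ = ∑ i, |c i|}.Nonempty := by
  have hn0 : (0 : ℝ) < Fintype.card d := by exact_mod_cast Fintype.card_pos
  refine ⟨_, exists_isWireCut hρ H hH hn (realizable_measurePrepare hρ.2 id)
    (f := (Fintype.card d : ℝ)⁻¹) (by positivity) ?_⟩
  rw [fid_measurePrepare]
  simp
  field_simp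

/-- Choose a feasible l < n − 1. Every operation has fidelity at most (1 + l)/n, so every cut has
overhead at least 2n/(1 + l) − 1 > 1. This bound is the same for all cuts, hence the inequality
stays strict for the infimum. -/
theorem one_lt_overhead [Nontrivial d] (hρ : IsDensity ρ) (H : Matrix d d ℂ)
    (hH : H.conjTranspose * H = 1)
    (hn : ∀ i j, H i j * star (H i j) = (Fintype.card d : ℂ)⁻¹)
    (hR : robustness ρ < Fintype.card d - 1) : 1 < overhead ρ := by
  obtain ⟨l, ⟨hl, ω, hω, hsep⟩, hlt⟩ := exists_lt_of_csInf_lt (robustness_set_nonempty hρ) hR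
  have hn0 : (0 : ℝ) < Fintype.card d := by exact_mod_cast Fintype.card_pos
  refine lt_of_lt_of_le (b := 2 * Fintype.card d / (1 + l) - 1) ?_
    (le_csInf (overhead_set_nonempty hρ H hH hn) ?_)
  · rw [lt_sub_iff_add_lt, lt_div_iff₀ (by positivity)]
    linarith
  · rintro κ ⟨N, c, F, hc, rfl⟩
    obtain ⟨i, hi⟩ := hc.exists_fid hρ
    have h₁ := (hc.1 i).fid_le hl hω hsep
    have h₂ : (0 : ℝ) ≤ ∑ i, |c i| := Finset.sum_nonneg fun i _ => abs_nonneg _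
    rw [sub_le_iff_le_add, div_le_iff₀ (by positivity)]
    have h₃ := hi.trans (mul_le_mul_of_nonneg_left h₁ (by positivity))
    nlinarith

theorem overhead_le [Nontrivial d] (hρ : IsDensity ρ) (H : Matrix d d ℂ)
    (hH : H.conjTranspose * H = 1)
    (hn : ∀ i j, H i j * star (H i j) = (Fintype.card d : ℂ)⁻¹)
    {E : SuperOp d d} (hE : Realizable ρ E) {p : ℝ} (hp : 0 ≤ p)
    (hpE : (Fintype.card d : ℝ) ^ 2 ≤ p * (fid E).re) : overhead ρ ≤ 2 * p - 1 := by
  have hn0 : (0 : ℝ) < Fintype.card d := by exact_mod_cast Fintype.card_pos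
  have hpf : 0 < p * (fid E).re := lt_of_lt_of_le (by positivity) hpE
  have hf0 : 0 < (fid E).re := pos_of_mul_pos_right hpf hp
  have hbdd : BddBelow {κ : ℝ | ∃ (N : ℕ) (c : Fin N → ℝ)
      (F : Fin N → SuperOp ((d × d) × d) ((d × d) × d)), IsWireCut ρ c F ∧ κ = ∑ i, |c i|} := by
    refine ⟨0, ?_⟩
    rintro κ ⟨N, c, F, hc, rfl⟩
    exact Finset.sum_nonneg fun i _ => abs_nonneg _
  refine (csInf_le hbdd (exists_isWireCut hρ H hH hn hE
    (f := (fid E).re / (Fintype.card d : ℝ) ^ 2) (by positivity) (by field_simp))).trans ?_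
  have : 1 / ((fid E).re / (Fintype.card d : ℝ) ^ 2) ≤ p := by
    rw [one_div_div, div_le_iff₀ hf0]
    exact hpE
  have h2 : 2 / ((fid E).re / (Fintype.card d : ℝ) ^ 2) =
    2 * (1 / ((fid E).re / (Fintype.card d : ℝ) ^ 2)) := by ring
  linarith

theorem ofReal_sqrt_two_mul_self : ((Real.sqrt 2 : ℝ) : ℂ) * (Real.sqrt 2 : ℝ) = 2 := by
  rw [← Complex.ofReal_mul, Real.mul_self_sqrt (by norm_num)]
  norm_num

/-- The Hadamard transform of a register of qubits. -/
def hadamard (n : ℕ) : Matrix (Qubits n) (Qubits n) ℂ :=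
  Matrix.of fun x y => ∏ i, ((Real.sqrt 2)⁻¹ : ℂ) * if x i = 1 ∧ y i = 1 then -1 else 1

theorem hadamard_mul_star (n : ℕ) (x y : Qubits n) :
    hadamard n x y * star (hadamard n x y) = (Fintype.card (Qubits n) : ℂ)⁻¹ := by
  have hp : ∀ i, (((Real.sqrt 2)⁻¹ : ℂ) * if x i = 1 ∧ y i = 1 then -1 else 1) *
      star (((Real.sqrt 2)⁻¹ : ℂ) * if x i = 1 ∧ y i = 1 then -1 else 1) = 2⁻¹ := by
    intro i
    rw [← ofReal_sqrt_two_mul_self, mul_inv]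
    split_ifs <;> simp
  simp only [hadamard, Matrix.of_apply, star_prod]
  rw [← Finset.prod_mul_distrib, Finset.prod_congr rfl fun i _ => hp i]
  simp

theorem hadamard_conjTranspose_mul (n : ℕ) : (hadamard n).conjTranspose * hadamard n = 1 := by
  have hp : ∀ a b : Fin 2, ∑ c : Fin 2, star (((Real.sqrt 2)⁻¹ : ℂ) *
      if c = 1 ∧ a = 1 then -1 else 1) * (((Real.sqrt 2)⁻¹ : ℂ) *
      if c = 1 ∧ b = 1 then -1 else 1) = if a = b then 1 else 0 := by
    have h3 : ((Real.sqrt 2 : ℝ) : ℂ)⁻¹ * ((Real.sqrt 2 : ℝ) : ℂ)⁻¹ = 2⁻¹ := by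
      rw [← mul_inv, ofReal_sqrt_two_mul_self]
    intro a b
    fin_cases a <;> fin_cases b <;> (simp [Fin.sum_univ_two, h3]; try norm_num [h3])
  ext y z
  simp only [Matrix.mul_apply, Matrix.conjTranspose_apply, hadamard, Matrix.of_apply, star_prod,
    ← Finset.prod_mul_distrib]
  rw [← Fintype.piFinset_univ, ← Finset.prod_univ_sum (fun _ => Finset.univ)
    (fun i c => star (((Real.sqrt 2)⁻¹ : ℂ) * if c = 1 ∧ y i = 1 then -1 else 1) *
      (((Real.sqrt 2)⁻¹ : ℂ) * if c = 1 ∧ z i = 1 then -1 else 1))]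
  simp only [hp, Matrix.one_apply]
  rw [Finset.prod_ite_zero]
  simp [funext_iff]

end Overhead

/-! ### Multiplicativity of the fidelity for tensor products of resources. -/

section Tensor

/-- Resources can be used in parallel, and the fidelities then multiply. -/
theorem exists_realizable_tensor {d' D : Type} [Fintype d'] [DecidableEq d'] [Fintype D]
    [DecidableEq D] (e : D ≃ d × d') {ρ' : Matrix (d' × d') (d' × d') ℂ}
    {τ : Matrix (D × D) (D × D) ℂ}
    (hτ : ∀ p q r s, τ (p, q) (r, s) = ρ ((e p).1, (e q).1) ((e r).1, (e s).1) *
      ρ' ((e p).2, (e q).2) ((e r).2, (e s).2))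
    {E : SuperOp d d} (hE : Realizable ρ E) {E' : SuperOp d' d'} (hE' : Realizable ρ' E') :
    ∃ T : SuperOp D D, Realizable τ T ∧ fid T = fid E * fid E' := by
  obtain ⟨F, hF, rfl⟩ := hE.exists_implement
  obtain ⟨F', hF', rfl⟩ := hE'.exists_implement
  obtain ⟨G, hG, hG'⟩ := hF.exists_tensor hF'
  -- The parallel protocol groups the sender's registers by factor, while the cut groups them by
  -- role. The regrouping is local to the sender.
  let eL : (d × d) × (d' × d') ≃ D × D :=
    (Equiv.prodProdProdComm d d d' d').trans (Equiv.prodCongr e.symm e.symm)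
  have hpre := IsLOCC.krausMap_kronecker _ (conjTranspose_one_submatrix_mul eL) _
    (conjTranspose_one_submatrix_mul e.symm)
  have hpost := IsLOCC.krausMap_kronecker _ (conjTranspose_one_submatrix_mul eL.symm) _
    (conjTranspose_one_submatrix_mul e)
  refine ⟨_, realizable_implement (hpost.comp (hG.comp hpre)), ?_⟩
  have hin : ∀ I J : D, (withResource (Matrix.single I J 1) τ).submatrix (Prod.map eL e.symm)
      (Prod.map eL e.symm) = tensor (withResource (Matrix.single (e I).1 (e J).1 1) ρ)
        (withResource (Matrix.single (e I).2 (e J).2 1) ρ') := by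
    intro I J
    ext ⟨⟨⟨a, b⟩, a', b'⟩, c, c'⟩ ⟨⟨⟨u, v⟩, u', v'⟩, w, w'⟩
    simp only [withResource, tensor, eL, Matrix.submatrix_apply, Matrix.kroneckerMap_apply,
      Prod.map_apply, Equiv.trans_apply, Equiv.prodProdProdComm_apply, Equiv.prodCongr_apply,
      Equiv.prodAssoc_apply, hτ, Equiv.apply_symm_apply, Matrix.single_apply,
      Equiv.eq_symm_apply, Prod.ext_iff]
    by_cases h1 : (e I).1 = a <;> by_cases h2 : (e I).2 = a' <;> by_cases h3 : (e J).1 = u <;>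
      by_cases h4 : (e J).2 = u' <;> simp [h1, h2, h3, h4]
  have hentry : ∀ I J : D, implement (krausMap ((1 : Matrix _ _ ℂ).submatrix eL.symm id ⊗ₖ
      (1 : Matrix _ _ ℂ).submatrix e id) ∘ₗ G ∘ₗ krausMap ((1 : Matrix _ _ ℂ).submatrix eL id ⊗ₖ
      (1 : Matrix _ _ ℂ).submatrix e.symm id)) τ (Matrix.single I J 1) I J =
        implement F ρ (Matrix.single (e I).1 (e J).1 1) (e I).1 (e J).1 *
        implement F' ρ' (Matrix.single (e I).2 (e J).2 1) (e I).2 (e J).2 := by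
    intro I J
    rw [implement_apply, LinearMap.comp_apply, LinearMap.comp_apply,
      one_submatrix_kronecker_one_submatrix, one_submatrix_kronecker_one_submatrix,
      krausMap_one_submatrix, krausMap_one_submatrix, hin, hG', implement_apply, implement_apply]
    simp only [traceFirst, Matrix.of_apply, Matrix.submatrix_apply, Prod.map_apply]
    rw [eL.symm.sum_comp (fun u => tensor (F (withResource (Matrix.single (e I).1 (e J).1 1) ρ))
      (F' (withResource (Matrix.single (e I).2 (e J).2 1) ρ')) (u, e I) (u, e J)),
      Fintype.sum_prod_type, Finset.sum_mul_sum]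
    rfl
  simp only [fid, hentry]
  rw [e.sum_comp (fun i => ∑ J, implement F ρ (Matrix.single i.1 (e J).1 1) i.1 (e J).1 *
        implement F' ρ' (Matrix.single i.2 (e J).2 1) i.2 (e J).2)]
  have : ∀ i : d × d', ∑ J, implement F ρ (Matrix.single i.1 (e J).1 1) i.1 (e J).1 *
        implement F' ρ' (Matrix.single i.2 (e J).2 1) i.2 (e J).2 =
      (∑ j, implement F ρ (Matrix.single i.1 j 1) i.1 j) *
        ∑ j, implement F' ρ' (Matrix.single i.2 j 1) i.2 j := by
    intro i
    rw [e.sum_comp (fun j => implement F ρ (Matrix.single i.1 j.1 1) i.1 j.1 *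
        implement F' ρ' (Matrix.single i.2 j.2 1) i.2 j.2), Fintype.sum_prod_type,
      Finset.sum_mul_sum]
  simp only [this]
  rw [Fintype.sum_prod_type, Finset.sum_mul_sum]

/-- The index type D is arbitrary up to an equivalence so that the induction runs on function types
and still applies to the joint qubit register. -/
theorem exists_realizable_pi (m : ℕ) : ∀ (δ : Fin m → Type) [∀ i, Fintype (δ i)]
    [∀ i, DecidableEq (δ i)] (ρ : ∀ i, Matrix (δ i × δ i) (δ i × δ i) ℂ)
    (E : ∀ i, SuperOp (δ i) (δ i)) (_ : ∀ i, Realizable (ρ i) (E i))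
    {D : Type} [Fintype D] [DecidableEq D] (e : D ≃ ∀ i, δ i) (τ : Matrix (D × D) (D × D) ℂ)
    (_ : ∀ p q r s, τ (p, q) (r, s) = ∏ i, ρ i (e p i, e q i) (e r i, e s i)),
    ∃ T : SuperOp D D, Realizable τ T ∧ fid T = ∏ i, fid (E i) := by
  induction m with
  | zero =>
    intro δ _ _ ρ E hE D _ _ e τ hτ
    have hu : Unique D := e.unique
    refine ⟨implement LinearMap.id τ, realizable_implement IsLOCC.done, ?_⟩
    simp [fid, implement_apply, traceFirst, withResource, Matrix.kroneckerMap_apply, hτ,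
      Fintype.sum_prod_type]
  | succ m ih =>
    intro δ _ _ ρ E hE D _ _ e τ hτ
    obtain ⟨T, hT, hT'⟩ := ih (fun i => δ i.succ) (fun i => ρ i.succ) (fun i => E i.succ)
      (fun i => hE i.succ) (Equiv.refl (∀ i : Fin m, δ i.succ))
      (Matrix.of fun p q => ∏ i : Fin m, ρ i.succ (p.1 i, p.2 i) (q.1 i, q.2 i))
      (fun _ _ _ _ => rfl)
    obtain ⟨T', h, h'⟩ := exists_realizable_tensor (e.trans (Fin.consEquiv δ).symm) (τ := τ)
      (fun p q r s => by rw [hτ, Fin.prod_univ_succ]; rfl) (hE 0) hT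
    exact ⟨T', h, by rw [h', hT', Fin.prod_univ_succ]⟩

theorem isDensity_pi (m : ℕ) : ∀ (δ : Fin m → Type) [∀ i, Fintype (δ i)]
    (ρ : ∀ i, Matrix (δ i × δ i) (δ i × δ i) ℂ) (_ : ∀ i, IsDensity (ρ i))
    {D : Type} [Fintype D] (e : D ≃ ∀ i, δ i) (τ : Matrix (D × D) (D × D) ℂ)
    (_ : ∀ p q r s, τ (p, q) (r, s) = ∏ i, ρ i (e p i, e q i) (e r i, e s i)), IsDensity τ := by
  induction m with
  | zero =>
    intro δ _ ρ hρ D _ e τ hτ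
    have hu : Unique D := e.unique
    classical
    have : τ = 1 := by
      ext ⟨p, q⟩ ⟨r, s⟩
      rw [hτ, Subsingleton.elim (p, q) (r, s)]
      simp
    rw [this]
    exact ⟨Matrix.PosSemidef.one, by simp [Matrix.trace_one]⟩
  | succ m ih =>
    intro δ _ ρ hρ D _ e τ hτ
    have h := ih (fun i => δ i.succ) (fun i => ρ i.succ) (fun i => hρ i.succ)
      (Equiv.refl (∀ i : Fin m, δ i.succ))
      (Matrix.of fun p q => ∏ i : Fin m, ρ i.succ (p.1 i, p.2 i) (q.1 i, q.2 i))
      (fun _ _ _ _ => rfl)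
    set τ' : Matrix ((∀ i : Fin m, δ i.succ) × (∀ i : Fin m, δ i.succ))
      ((∀ i : Fin m, δ i.succ) × (∀ i : Fin m, δ i.succ)) ℂ :=
      Matrix.of fun p q => ∏ i : Fin m, ρ i.succ (p.1 i, p.2 i) (q.1 i, q.2 i)
    let e' := e.trans (Fin.consEquiv δ).symm
    let w := (Equiv.prodCongr e' e').trans (Equiv.prodProdProdComm _ _ _ _)
    have hw : τ = (ρ 0 ⊗ₖ τ').submatrix w w := by
      ext ⟨p, q⟩ ⟨r, s⟩
      rw [hτ, Fin.prod_univ_succ]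
      rfl
    rw [hw]
    refine ⟨((hρ 0).1.kronecker h.1).submatrix w, ?_⟩
    have : ((ρ 0 ⊗ₖ τ').submatrix w w).trace = (ρ 0 ⊗ₖ τ').trace :=
      w.sum_comp (fun p => (ρ 0 ⊗ₖ τ') p p)
    rw [this, Matrix.trace_kronecker, (hρ 0).2, h.2, one_mul]

end Tensor

end Realizable

/-! ### The elementary inequality and submultiplicativity. -/

section Main

theorem one_le_prod_half_add_one (m : ℕ) (x : Fin m → ℝ) (hx : ∀ i, 1 < x i) :
    1 ≤ ∏ i, (x i + 1) / 2 :=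
  Finset.one_le_prod fun i _ => by linarith [hx i]

theorem two_mul_prod_half_add_one_sub_one_le (m : ℕ) :
    ∀ x : Fin m → ℝ, (∀ i, 1 < x i) → 2 * ∏ i, (x i + 1) / 2 - 1 ≤ ∏ i, x i := by
  induction m with
  | zero => intro x _; simp; norm_num
  | succ m ih =>
    intro x hx
    have h₁ := ih (fun i => x i.succ) fun i => hx _
    have h₂ := one_le_prod_half_add_one m (fun i => x i.succ) fun i => hx _
    rw [Fin.prod_univ_succ, Fin.prod_univ_succ]
    have h₀ := hx 0
    -- With P the product over the tail, x₀(2P − 1) − ((x₀ + 1)P − 1) = (x₀ − 1)(P − 1).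
    nlinarith [mul_nonneg (sub_nonneg.2 h₀.le) (sub_nonneg.2 h₂)]

theorem two_mul_prod_half_add_one_sub_one_lt {m : ℕ} (hm : 2 ≤ m) (x : Fin m → ℝ)
    (hx : ∀ i, 1 < x i) : 2 * ∏ i, (x i + 1) / 2 - 1 < ∏ i, x i := by
  obtain ⟨m, rfl⟩ := Nat.exists_eq_add_of_le' hm
  have h₁ := two_mul_prod_half_add_one_sub_one_le (m + 1) (fun i => x i.succ) fun i => hx _
  -- The same identity gives strictness once the tail product exceeds 1, for which the tail must be
  -- nonempty. This is where m ≥ 2 enters.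
  have h₂ : 1 < ∏ i : Fin (m + 1), (x i.succ + 1) / 2 := by
    rw [Fin.prod_univ_succ]
    have := one_le_prod_half_add_one m (fun i => x i.succ.succ) fun i => hx _
    have h := hx (Fin.succ 0)
    nlinarith
  rw [Fin.prod_univ_succ, Fin.prod_univ_succ (fun i => x i)]
  have h₀ := hx 0
  nlinarith [mul_pos (sub_pos.2 h₀) (sub_pos.2 h₂)]

/-- The joint register as a product of its blocks. -/
def blockEquiv {m : ℕ} (k : Fin m → ℕ) : Qubits (∑ i, k i) ≃ ∀ i, Qubits (k i) :=
  (Equiv.arrowCongr finSigmaFinEquiv.symm (Equiv.refl _)).trans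
    (Equiv.piCurry fun i (_ : Fin (k i)) => Fin 2)

theorem card_qubits (n : ℕ) : Fintype.card (Qubits n) = 2 ^ n := by simp

theorem nontrivial_qubits {n : ℕ} (hn : n ≠ 0) : Nontrivial (Qubits n) := by
  have : Nonempty (Fin n) := ⟨⟨0, Nat.pos_of_ne_zero hn⟩⟩
  infer_instance

theorem robustness_nonneg {a b : Type} [Fintype a] [Fintype b]
    (ρ : Matrix (a × b) (a × b) ℂ) : 0 ≤ robustness ρ :=
  Real.sInf_nonneg fun _ h => h.1

variable {m : ℕ} {k : Fin m → ℕ}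
  {ρ : ∀ i, Matrix (Qubits (k i) × Qubits (k i)) (Qubits (k i) × Qubits (k i)) ℂ}

/-- Near-optimal cuts of the factors contain operations of large fidelity, whose parallel run gives
a cut of the composite. The slack t is there because the infima need not be attained. -/
theorem overhead_compositeState_le_of_pos (hk : ∑ i, k i ≠ 0) (hk' : ∀ i, k i ≠ 0)
    (hρ : ∀ i, IsDensity (ρ i)) {t : ℝ} (ht : 0 < t) :
    overhead (compositeState ρ) ≤ 2 * ∏ i, (overhead (ρ i) + t + 1) / 2 - 1 := by
  have hnt := nontrivial_qubits hk
  have hcut : ∀ i, ∃ E : SuperOp (Qubits (k i)) (Qubits (k i)), Realizable (ρ i) E ∧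
      ∃ f : ℝ, fid E = f ∧ 0 ≤ f ∧ ((2 : ℝ) ^ k i) ^ 2 ≤ (overhead (ρ i) + t + 1) / 2 * f ∧
        0 ≤ (overhead (ρ i) + t + 1) / 2 := by
    intro i
    have hnt := nontrivial_qubits (hk' i)
    obtain ⟨κ, ⟨N, c, F, hc, rfl⟩, hκ⟩ := exists_lt_of_csInf_lt
      (overhead_set_nonempty (hρ i) _ (hadamard_conjTranspose_mul _) (hadamard_mul_star _))
      (show overhead (ρ i) < overhead (ρ i) + t by linarith)
    obtain ⟨j, hj⟩ := hc.exists_fid (hρ i)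
    obtain ⟨f, -, hf, -, hf0, -⟩ := (hc.1 j).fid_tr_bounds (hρ i)
    have h0 : (0 : ℝ) ≤ ∑ i, |c i| := Finset.sum_nonneg fun i _ => abs_nonneg _
    refine ⟨_, realizable_implement (hc.1 j), f, hf, hf0, ?_, by linarith⟩
    rw [hf, Complex.ofReal_re, card_qubits, Nat.cast_pow, Nat.cast_ofNat] at hj
    exact hj.trans (by gcongr)
  choose E hE f hf hf0 hfb hp using hcut
  have hcomp : ∀ p q r s, compositeState ρ (p, q) (r, s) =
      ∏ i, ρ i (blockEquiv k p i, blockEquiv k q i) (blockEquiv k r i, blockEquiv k s i) :=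
    fun p q r s => rfl
  obtain ⟨T, hT, hTf⟩ := exists_realizable_pi m (fun i => Qubits (k i)) ρ E hE (blockEquiv k)
    (compositeState ρ) hcomp
  refine overhead_le (isDensity_pi m (fun i => Qubits (k i)) ρ hρ (blockEquiv k) _ hcomp) _
    (hadamard_conjTranspose_mul _) (hadamard_mul_star _) hT
    (Finset.prod_nonneg fun i _ => hp i) ?_
  have hre : (fid T).re = ∏ i, f i := by
    rw [hTf]
    simp only [hf]
    rw [← Complex.ofReal_prod, Complex.ofReal_re]
  rw [hre, ← Finset.prod_mul_distrib, card_qubits, Nat.cast_pow, Nat.cast_ofNat,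
    ← Finset.prod_pow_eq_pow_sum, ← Finset.prod_pow]
  exact Finset.prod_le_prod (fun i _ => by positivity) fun i _ => hfb i

theorem overhead_compositeState_le (hk : ∑ i, k i ≠ 0) (hk' : ∀ i, k i ≠ 0)
    (hρ : ∀ i, IsDensity (ρ i)) :
    overhead (compositeState ρ) ≤ 2 * ∏ i, (overhead (ρ i) + 1) / 2 - 1 := by
  have hcont : Continuous fun t : ℝ => 2 * ∏ i, (overhead (ρ i) + t + 1) / 2 - 1 := by fun_prop
  have hlim := (hcont.tendsto 0).mono_left (nhdsWithin_le_nhds (s := Set.Ioi 0))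
  simp only [add_zero] at hlim
  refine ge_of_tendsto hlim ?_
  filter_upwards [self_mem_nhdsWithin] with t ht
  exact overhead_compositeState_le_of_pos hk hk' hρ ht

end Main
end WireCut

end

theorem theorem2 (m : ℕ) (hm : 2 ≤ m) (k : Fin m → ℕ)
    (ρ : ∀ i, Matrix (WireCut.Qubits (k i) × WireCut.Qubits (k i))
      (WireCut.Qubits (k i) × WireCut.Qubits (k i)) ℂ)
    (hρ : ∀ i, WireCut.IsDensity (ρ i))
    (hNME : ∀ i, WireCut.robustness (ρ i) < 2 ^ k i - 1) :
    WireCut.overhead (WireCut.compositeState ρ) < ∏ i, WireCut.overhead (ρ i) := by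
  -- For an empty register the bound would read R < 2⁰ − 1 = 0, contradicting R ≥ 0.
  have hk' : ∀ i, k i ≠ 0 := by
    intro i h0
    have h := (WireCut.robustness_nonneg (ρ i)).trans_lt (hNME i)
    rw [h0] at h
    norm_num at h
  have hk : ∑ i, k i ≠ 0 := by
    intro h
    exact hk' ⟨0, by lia⟩ (Finset.sum_eq_zero_iff.1 h _ (Finset.mem_univ _))
  refine (WireCut.overhead_compositeState_le hk hk' hρ).trans_lt
    (WireCut.two_mul_prod_half_add_one_sub_one_lt hm _ fun i => ?_)
  have hnt := WireCut.nontrivial_qubits (hk' i)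
  refine WireCut.one_lt_overhead (hρ i) _ (WireCut.hadamard_conjTranspose_mul _)
    (WireCut.hadamard_mul_star _) ?_
  rw [WireCut.card_qubits, Nat.cast_pow, Nat.cast_ofNat]
  exact hNME i
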